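/- Theorem 1.3. Let $n\ge 1$ and let $F:\Sigma^n\to\mathbb{R}^{n+1}$ be a smooth proper immersion of a connected, noncompact, smooth $n$-manifold $\Sigma$ without boundary. Suppose that $F$ is a self-shrinker of mean curvature flow, i.e. $$\Delta_g F=-\tfrac12 F^{\perp},$$ where $g$ is the induced metric, $\Delta_g$ its Laplace–Beltrami operator (so $\Delta_gF$ is the mean curvature vector) and $F^\perp$ is the component of the position vector normal to the hypersurface. Suppose further that $\Sigma$ is oriented and almost graphical: there is a continuous unit normal field $N:\Sigma\to\mathbb{R}^{n+1}$ along $F$ with $\langle N(p),e_{n+1}\rangle\ge 0$ for all $p\in\Sigma$, where $e_{n+1}=(0,\dots,0,1)$. Then at least one of the following holds. (i) $\Sigma$ is a hyperplane: $F$ is injective and its image is an $n$-dimensional linear subspace of $\mathbb{R}^{n+1}$. (ii) $\Sigma$ is a cylinder $\bar\Sigma^{n-1}\times\mathbb{R}$ over a self-shrinker: there are a connected smooth $(n-1)$-manifold $\bar\Sigma$, a smooth proper immersion $\bar F:\bar\Sigma\to\mathbb{R}^{n}$ satisfying $\Delta_{\bar g}\bar F=-\tfrac12\bar F^{\perp}$,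 where $\bar g$ is the metric induced by $\bar F$, and a diffeomorphism $\Sigma\cong\bar\Sigma\times\mathbb{R}$ under which $F$ becomes $(s,t)\mapsto(\bar F(s),t)\in\mathbb{R}^{n}\times\mathbb{R}$. -/

import Mathlib

open scoped Manifold ContDiff InnerProductSpace

noncomputable section

namespace Shrinker

universe u

/-- The Euclidean space `ℝᵏ`. -/
abbrev E (k : ℕ) : Type := EuclideanSpace ℝ (Fin k)

/-! ### The induced metric and its Laplace–Beltrami operator in a local parametrization -/

/-- The matrix `g i j = ⟪∂ᵢ f, ∂ⱼ f⟫` of the metric induced by `f`, at the point `y`. -/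
def inducedMetric {n k : ℕ} (f : E n → E k) (y : E n) : Matrix (Fin n) (Fin n) ℝ :=
  Matrix.of fun i j =>
    ⟪fderiv ℝ f y (EuclideanSpace.single i 1), fderiv ℝ f y (EuclideanSpace.single j 1)⟫_ℝ

/-- The Laplace–Beltrami operator of the metric `g` induced by `f`, applied to `h` at `y`:
`Δ_g h = (1 / √(det g)) ∑ᵢ ∂ᵢ (√(det g) ∑ⱼ gⁱʲ ∂ⱼ h)`. For vector valued `h` it acts on each
component. -/
def laplaceBeltrami {n k l : ℕ} (f : E n → E k) (h : E n → E l) (y : E n) : E l :=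
  (√(inducedMetric f y).det)⁻¹ • ∑ i : Fin n,
    fderiv ℝ (fun z => √(inducedMetric f z).det •
      ∑ j : Fin n, (inducedMetric f z)⁻¹ i j • fderiv ℝ h z (EuclideanSpace.single j 1))
      y (EuclideanSpace.single i 1)

section Immersed

variable {n k : ℕ} {M : Type u} [TopologicalSpace M] [ChartedSpace (E n) M]

/-- The tangent space at `p` of the immersed manifold, as a linear subspace of `ℝᵏ`:
the range of the differential `dF_p`. -/
def tangentImage (F : M → E k) (p : M) : Submodule ℝ (E k) :=
  LinearMap.range (mfderiv (𝓡 n) 𝓘(ℝ, E k) F p : E n →L[ℝ] E k).toLinearMap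

/-- The normal component `F^⊥` of the position vector at `p`. -/
def normalPosition (F : M → E k) (p : M) : E k :=
  (tangentImage (n := n) F p)ᗮ.starProjection (F p)

/-- `F` is a smooth, properly immersed self-shrinker in `ℝᵏ`: a smooth proper immersion with
`Δ_g F = - (1 / 2) F^⊥`, where `g` is the induced metric and `Δ_g F` (the mean curvature
vector) is computed in smooth charts. -/
structure IsProperSelfShrinker (F : M → E k) : Prop where
  smooth : ContMDiff (𝓡 n) 𝓘(ℝ, E k) ∞ F
  immersion : ∀ p : M, Function.Injective (mfderiv (𝓡 n) 𝓘(ℝ, E k) F p)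
  proper : IsProperMap F
  shrinker : ∀ e ∈ IsManifold.maximalAtlas (𝓡 n) ∞ M, ∀ p ∈ e.source,
    laplaceBeltrami (F ∘ e.symm) (F ∘ e.symm) (e p) = -(1 / 2 : ℝ) • normalPosition (n := n) F p

/-- `N` is a (globally defined, continuous) unit normal field along the immersion `F`. For a
hypersurface in Euclidean space such a field is the same thing as an orientation. -/
structure IsUnitNormalField (F N : M → E k) : Prop where
  continuous : Continuous N
  norm_eq_one : ∀ p, ‖N p‖ = 1
  normal : ∀ p, N p ∈ (tangentImage (n := n) F p)ᗮ

end Immersed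

/-- The oriented hypersurface `F : M → ℝⁿ⁺¹` is almost graphical: for one choice of the unit
normal field, all unit normals lie in the closed upper hemisphere. -/
def IsAlmostGraphical {n : ℕ} {M : Type u} [TopologicalSpace M] [ChartedSpace (E n) M]
    (F : M → E (n + 1)) : Prop :=
  ∃ N : M → E (n + 1), IsUnitNormalField (n := n) F N ∧ ∀ p, 0 ≤ N p (Fin.last n)

/-- `F` maps `M` bijectively onto a hyperplane through the origin of `ℝⁿ⁺¹`. -/
def IsHyperplane {n : ℕ} {M : Type u} (F : M → E (n + 1)) : Prop :=
  Function.Injective F ∧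
    ∃ P : Submodule ℝ (E (n + 1)), Module.finrank ℝ P = n ∧ Set.range F = P

/-- The point `(x, t)` of `ℝᵏ × ℝ = ℝᵏ⁺¹`. -/
def snoc {k : ℕ} (x : E k) (t : ℝ) : E (k + 1) :=
  WithLp.toLp 2 (Fin.snoc (α := fun _ => ℝ) x.ofLp t)

/-- `F : M → ℝⁿ⁺²` is a cylinder `S × ℝ` over a self-shrinker: there are a connected smooth
manifold `S` of dimension `n`, a properly immersed self-shrinker `G : S → ℝⁿ⁺¹`, and a
diffeomorphism `M ≅ S × ℝ` under which `F` becomes `(s, t) ↦ (G s, t)`. -/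
def IsShrinkerCylinder {n : ℕ} {M : Type u} [TopologicalSpace M] [ChartedSpace (E (n + 1)) M]
    (F : M → E (n + 1 + 1)) : Prop :=
  ∃ (S : Type u) (_ : TopologicalSpace S) (_ : ChartedSpace (E n) S)
    (_ : IsManifold (𝓡 n) ∞ S) (_ : T2Space S) (_ : SecondCountableTopology S)
    (_ : ConnectedSpace S)
    (G : S → E (n + 1)) (Φ : M ≃ₘ⟮𝓡 (n + 1), (𝓡 n).prod 𝓘(ℝ, ℝ)⟯ (S × ℝ)),
    IsProperSelfShrinker (n := n) G ∧ ∀ p : M, F p = snoc (G (Φ p).1) (Φ p).2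

end Shrinker

end

/-!
The function `v = ⟪N, e⟫`, with `e` the vertical unit vector, is nonnegative, and on a self-shrinker
it satisfies `Δ v - ⟨F, ∇ v⟩ / 2 + |A|² v = 0`, the Jacobi equation for the normal component of a
translation. So it is a supersolution of the drift Laplacian `L = Δ - ⟨F, ∇ ·⟩ / 2`. A strong minimum principle makes it constant, and the two cases of the
theorem are the cases of a positive constant and of zero.

No second fundamental form is needed. Near each point the immersion is the graph of a function `u`
over the tangent plane at that point, and there `v ≤ φ` with equality at the point, where
`φ = ⟪ν, e⟫ - D_c u` is an affine function of the gradient (`IsGraphChart.eventually_inner_le`).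
Differentiating the graph equation gives `L φ = 0` at the centre
(`laplacian_dirDeriv_of_horizontal`). Hence a smooth function of the position that touches `v` from
below satisfies `L h ≤ 0` at the contact point (`driftLaplacian_nonpos_of_touching`): `v` is a
supersolution in the viscosity sense, which is all that the maximum principles use.

* Since `L |F|² = 2m - |F|²` in dimension `m`, properness lets `v + ε |F|²` attain its minimum, and
  only where `|F|² ≤ 2m`; letting `ε` tend to zero, `v` attains its minimum
  (`exists_forall_inner_le`).
* Hopf's barrier argument, carried out with Euclidean balls in the ambient space and the locally
  injective map `F`, shows that the set of minimum points is open
  (`mem_nhds_setOf_inner_eq_min`). So `v` is constant (`inner_normal_const`).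
* If the constant is positive, comparing the Laplacians in `φ² = c² (1 + |Du|²)` shows that the
  Hessian of `u` vanishes at the centre. So `N` is constant, the image lies in the hyperplane
  orthogonal to `N`, and `F` is a proper local homeomorphism to that hyperplane, hence a bijection,
  the hyperplane being simply connected (`isHyperplane_of_inner_const`).
* If it is zero, the vertical direction is tangent everywhere. In suitable charts `F` moves
  vertically along the last coordinate; properness turns this into a complete vertical flow
  (`exists_isVerticalFlow`), which identifies the manifold with the product of its slice of height
  zero and `ℝ`. The Laplace–Beltrami operator and the normal projection split accordingly, so the
  slice is again a self-shrinker (`IsProperSelfShrinker.base`).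
-/

namespace Shrinker

open Set Filter
open scoped Topology

/-! ### Directional derivatives -/

section Calculus

variable {V W : Type*} [NormedAddCommGroup V] [NormedSpace ℝ V]
  [NormedAddCommGroup W] [NormedSpace ℝ W]

/-- The derivative of `g` in the constant direction `a`, as a function of the base point, so that
it can be iterated. -/
noncomputable def dirDeriv (a : V) (g : V → W) : V → W := fun z => fderiv ℝ g z a

theorem dirDeriv_contDiffOn {U : Set V} (hU : IsOpen U) {g : V → W} (hg : ContDiffOn ℝ ∞ g U)
    (a : V) : ContDiffOn ℝ ∞ (dirDeriv a g) U :=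
  (hg.fderiv_of_isOpen hU (by simp)).clm_apply contDiffOn_const

theorem differentiableAt_of_contDiffOn {U : Set V} (hU : IsOpen U) {g : V → W}
    (hg : ContDiffOn ℝ ∞ g U) {z : V} (hz : z ∈ U) : DifferentiableAt ℝ g z :=
  (hg.contDiffAt (hU.mem_nhds hz)).differentiableAt (by simp)

theorem dirDeriv_congr {g h : V → W} {z : V} (H : g =ᶠ[𝓝 z] h) (a : V) :
    dirDeriv a g z = dirDeriv a h z := by
  simp only [dirDeriv, H.fderiv_eq]

theorem dirDeriv_dirDeriv {g : V → W} {z : V} (hd : DifferentiableAt ℝ (fderiv ℝ g) z) (a b : V) :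
    dirDeriv a (dirDeriv b g) z = fderiv ℝ (fderiv ℝ g) z a b := by
  change fderiv ℝ (fun y => fderiv ℝ g y b) z a = _
  rw [fderiv_clm_apply hd (differentiableAt_const b)]
  simp

theorem dirDeriv_comm {U : Set V} (hU : IsOpen U) {g : V → W} (hg : ContDiffOn ℝ ∞ g U)
    {z : V} (hz : z ∈ U) (a b : V) :
    dirDeriv a (dirDeriv b g) z = dirDeriv b (dirDeriv a g) z := by
  have hd : DifferentiableAt ℝ (fderiv ℝ g) z :=
    differentiableAt_of_contDiffOn hU (hg.fderiv_of_isOpen hU (by simp)) hz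
  rw [dirDeriv_dirDeriv hd, dirDeriv_dirDeriv hd]
  exact ((hg.contDiffAt (hU.mem_nhds hz)).isSymmSndFDerivAt (by
    rw [minSmoothness_of_isRCLikeNormedField]; exact WithTop.coe_le_coe.mpr le_top)) a b

theorem dirDeriv_add {g h : V → W} {z : V} (hg : DifferentiableAt ℝ g z)
    (hh : DifferentiableAt ℝ h z) (a : V) :
    dirDeriv a (fun y => g y + h y) z = dirDeriv a g z + dirDeriv a h z := by
  simp [dirDeriv, fderiv_fun_add hg hh]

theorem dirDeriv_sub {g h : V → W} {z : V} (hg : DifferentiableAt ℝ g z)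
    (hh : DifferentiableAt ℝ h z) (a : V) :
    dirDeriv a (fun y => g y - h y) z = dirDeriv a g z - dirDeriv a h z := by
  simp [dirDeriv, fderiv_fun_sub hg hh]

theorem dirDeriv_mul {g h : V → ℝ} {z : V} (hg : DifferentiableAt ℝ g z)
    (hh : DifferentiableAt ℝ h z) (a : V) :
    dirDeriv a (fun y => g y * h y) z = g z * dirDeriv a h z + h z * dirDeriv a g z := by
  simp [dirDeriv, fderiv_fun_mul hg hh]

theorem dirDeriv_const_mul {h : V → ℝ} {z : V} (c : ℝ)
    (hh : DifferentiableAt ℝ h z) (a : V) :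
    dirDeriv a (fun y => c * h y) z = c * dirDeriv a h z := by
  simp [dirDeriv, fderiv_const_mul hh]

theorem dirDeriv_dirDeriv_sq {U : Set V} (hU : IsOpen U) {g : V → ℝ} (hg : ContDiffOn ℝ ∞ g U)
    {z : V} (hz : z ∈ U) (a : V) :
    dirDeriv a (dirDeriv a (fun y => g y ^ 2)) z =
      2 * dirDeriv a g z ^ 2 + 2 * g z * dirDeriv a (dirDeriv a g) z := by
  have h1 : dirDeriv a (fun y => g y ^ 2) =ᶠ[𝓝 z] fun y => 2 * (g y * dirDeriv a g y) := by
    filter_upwards [hU.mem_nhds hz] with y hy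
    have hd := differentiableAt_of_contDiffOn hU hg hy
    simp only [sq]
    rw [dirDeriv_mul hd hd]; ring
  have hd := differentiableAt_of_contDiffOn hU hg hz
  have hd' := differentiableAt_of_contDiffOn hU (dirDeriv_contDiffOn hU hg a) hz
  rw [dirDeriv_congr h1, dirDeriv_const_mul _ (hd.fun_mul hd'), dirDeriv_mul hd hd']
  ring

theorem dirDeriv_const_sub (c : ℝ) (h : V → ℝ) (z a : V) :
    dirDeriv a (fun y => c - h y) z = - dirDeriv a h z := by
  simp [dirDeriv, fderiv_const_sub]

theorem dirDeriv_sub_const (c : W) (h : V → W) (z a : V) :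
    dirDeriv a (fun y => h y - c) z = dirDeriv a h z := by
  simp [dirDeriv, fderiv_sub_const]

theorem dirDeriv_const_add (c : W) (h : V → W) (z a : V) :
    dirDeriv a (fun y => c + h y) z = dirDeriv a h z := by
  simp [dirDeriv, fderiv_const_add]

theorem dirDeriv_sum {ι : Type*} (s : Finset ι) {g : ι → V → W} {z : V}
    (hg : ∀ i ∈ s, DifferentiableAt ℝ (g i) z) (a : V) :
    dirDeriv a (fun y => ∑ i ∈ s, g i y) z = ∑ i ∈ s, dirDeriv a (g i) z := by
  simp [dirDeriv, fderiv_fun_sum hg]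

theorem hasDerivAt_line {g : V → W} {y a : V} {t : ℝ}
    (hg : DifferentiableAt ℝ g (y + t • a)) :
    HasDerivAt (fun s : ℝ => g (y + s • a)) (dirDeriv a g (y + t • a)) t := by
  have h1 : HasDerivAt (fun s : ℝ => y + s • a) a t := by
    simpa using ((hasDerivAt_id t).smul_const a).const_add y
  exact hg.hasFDerivAt.comp_hasDerivAt t h1

/-- At a local minimum of a function of one variable the second derivative is nonnegative. -/
theorem deriv_deriv_nonneg_of_isLocalMin {k : ℝ → ℝ} {t : ℝ} (hk : IsLocalMin k t)
    (hc : ContinuousAt k t) : 0 ≤ deriv (deriv k) t := by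
  by_contra! hneg
  -- otherwise `t` is also a local maximum, so `k` is locally constant
  have hmax := isLocalMax_of_deriv_deriv_neg hneg hk.deriv_eq_zero hc
  have hconst : k =ᶠ[𝓝 t] fun _ => k t := by
    filter_upwards [hk, hmax] with s h1 h2 using le_antisymm h2 h1
  have h1 : deriv (deriv k) t = 0 := by
    rw [(hconst.deriv).deriv_eq]; simp
  exact hneg.ne h1

theorem dirDeriv_eq_zero_of_isLocalMin {g : V → ℝ} {y : V} (hmin : IsLocalMin g y) (a : V) :
    dirDeriv a g y = 0 := by
  simp [dirDeriv, hmin.fderiv_eq_zero]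

theorem dirDeriv_dirDeriv_nonneg_of_isLocalMin {U : Set V} (hU : IsOpen U) {g : V → ℝ}
    (hg : ContDiffOn ℝ ∞ g U) {y : V} (hy : y ∈ U) (hmin : IsLocalMin g y) (a : V) :
    0 ≤ dirDeriv a (dirDeriv a g) y := by
  have hcont : Continuous fun s : ℝ => y + s • a := by fun_prop
  have htend : Tendsto (fun s : ℝ => y + s • a) (𝓝 0) (𝓝 y) := by
    simpa using hcont.tendsto 0
  have hmem : ∀ᶠ s : ℝ in 𝓝 0, y + s • a ∈ U := htend.eventually (hU.mem_nhds hy)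
  set k : ℝ → ℝ := fun s => g (y + s • a) with hk
  have hd : deriv k =ᶠ[𝓝 0] fun s => dirDeriv a g (y + s • a) := by
    filter_upwards [hmem] with s hs
    exact (hasDerivAt_line (differentiableAt_of_contDiffOn hU hg hs)).deriv
  have hdd : deriv (deriv k) 0 = dirDeriv a (dirDeriv a g) y := by
    rw [hd.deriv_eq]
    have := (hasDerivAt_line (y := y) (a := a) (t := 0) (g := dirDeriv a g)
      (differentiableAt_of_contDiffOn hU (dirDeriv_contDiffOn hU hg a) (by simpa using hy))).deriv
    simpa using this
  rw [← hdd]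
  refine deriv_deriv_nonneg_of_isLocalMin ?_ ?_
  · have : ∀ᶠ s : ℝ in 𝓝 0, g y ≤ g (y + s • a) := htend.eventually hmin
    simpa [IsLocalMin, IsMinFilter, hk] using this
  · have h0 : DifferentiableAt ℝ g (y + (0 : ℝ) • a) := by
      simpa using differentiableAt_of_contDiffOn hU hg hy
    exact (hasDerivAt_line h0).continuousAt

end Calculus

/-! ### Graphs over a hyperplane -/

/-- The `i`-th standard basis vector of `ℝᵐ`. -/
noncomputable abbrev stdVec {m : ℕ} (i : Fin m) : E m := EuclideanSpace.single i 1

theorem sum_smul_stdVec {m : ℕ} (x : E m) : ∑ i, x i • (stdVec i : E m) = x := by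
  have := (EuclideanSpace.basisFun (Fin m) ℝ).sum_repr x
  simpa using this

theorem sum_smul_dirDeriv_stdVec {m : ℕ} {W : Type*} [NormedAddCommGroup W] [NormedSpace ℝ W]
    (g : E m → W) (x z : E m) : ∑ i, x i • dirDeriv (stdVec i) g z = dirDeriv x g z := by
  conv_rhs => rw [← sum_smul_stdVec x]
  simp only [dirDeriv, map_sum, map_smul]

section Graph

variable {m : ℕ} {B : E m →ₗᵢ[ℝ] E (m + 1)} {ν : E (m + 1)} {U : Set (E m)} {u : E m → ℝ}
  {f : E m → E (m + 1)}

theorem fderiv_graph (hU : IsOpen U) (hu : ContDiffOn ℝ ∞ u U)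
    (hf : ∀ z ∈ U, f z = B z + u z • ν) {z : E m} (hz : z ∈ U) (x : E m) :
    fderiv ℝ f z x = B x + dirDeriv x u z • ν := by
  have h1 : f =ᶠ[𝓝 z] fun y => B.toContinuousLinearMap y + u y • ν := by
    filter_upwards [hU.mem_nhds hz] with y hy using hf y hy
  have hd := differentiableAt_of_contDiffOn hU hu hz
  rw [h1.fderiv_eq, fderiv_fun_add (by fun_prop) (by fun_prop), fderiv_smul_const hd,
    ContinuousLinearMap.fderiv]
  rfl

/-- `|Du|²` at `z`. -/
noncomputable def gradSq (u : E m → ℝ) (z : E m) : ℝ := ∑ k, dirDeriv (stdVec k) u z ^ 2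

theorem gradSq_nonneg (u : E m → ℝ) (z : E m) : 0 ≤ gradSq u z :=
  Finset.sum_nonneg fun _ _ => sq_nonneg _

theorem gradSq_contDiffOn (hU : IsOpen U) (hu : ContDiffOn ℝ ∞ u U) :
    ContDiffOn ℝ ∞ (gradSq u) U :=
  ContDiffOn.sum fun _ _ => (dirDeriv_contDiffOn hU hu _).pow 2

/-- The entries `gⁱʲ = δᵢⱼ - uᵢuⱼ / (1 + |Du|²)` of the inverse metric of the graph of `u`. -/
noncomputable def graphCoeff (u : E m → ℝ) (i j : Fin m) (z : E m) : ℝ :=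
  (if i = j then 1 else 0) -
    dirDeriv (stdVec i) u z * dirDeriv (stdVec j) u z / (1 + gradSq u z)

theorem graphCoeff_contDiffOn (hU : IsOpen U) (hu : ContDiffOn ℝ ∞ u U) (i j : Fin m) :
    ContDiffOn ℝ ∞ (graphCoeff u i j) U :=
  contDiffOn_const.sub (((dirDeriv_contDiffOn hU hu _).mul (dirDeriv_contDiffOn hU hu _)).div
    (contDiffOn_const.add (gradSq_contDiffOn hU hu))
    fun z _ => by have := gradSq_nonneg u z; positivity)

theorem inducedMetric_graph (hν : ‖ν‖ = 1) (hB : ∀ x, ⟪B x, ν⟫_ℝ = 0)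
    (hU : IsOpen U) (hu : ContDiffOn ℝ ∞ u U)
    (hf : ∀ z ∈ U, f z = B z + u z • ν) {z : E m} (hz : z ∈ U) :
    inducedMetric f z =
      1 + Matrix.replicateCol Unit (fun i => dirDeriv (stdVec i) u z) *
        Matrix.replicateRow Unit (fun i => dirDeriv (stdVec i) u z) := by
  ext i j
  have hB' : ∀ x, ⟪ν, B x⟫_ℝ = 0 := fun x => by rw [real_inner_comm]; exact hB x
  simp only [inducedMetric, Matrix.of_apply, fderiv_graph hU hu hf hz, inner_add_left,
    inner_add_right, inner_smul_left, inner_smul_right, hB, hB', B.inner_map_map,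
    real_inner_self_eq_norm_sq, hν]
  have hij : ⟪(stdVec i : E m), stdVec j⟫_ℝ = if i = j then 1 else 0 := by
    simp [EuclideanSpace.inner_single_left]
  rw [hij]
  simp [Matrix.mul_apply, Matrix.one_apply, mul_comm]

theorem det_inducedMetric_graph (hν : ‖ν‖ = 1) (hB : ∀ x, ⟪B x, ν⟫_ℝ = 0)
    (hU : IsOpen U) (hu : ContDiffOn ℝ ∞ u U)
    (hf : ∀ z ∈ U, f z = B z + u z • ν) {z : E m} (hz : z ∈ U) :
    (inducedMetric f z).det = 1 + gradSq u z := by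
  rw [inducedMetric_graph hν hB hU hu hf hz, Matrix.det_one_add_replicateCol_mul_replicateRow]
  simp [dotProduct, gradSq, sq]

theorem inv_inducedMetric_graph (hν : ‖ν‖ = 1) (hB : ∀ x, ⟪B x, ν⟫_ℝ = 0)
    (hU : IsOpen U) (hu : ContDiffOn ℝ ∞ u U)
    (hf : ∀ z ∈ U, f z = B z + u z • ν) {z : E m} (hz : z ∈ U) :
    (inducedMetric f z)⁻¹ = Matrix.of fun i j => graphCoeff u i j z := by
  rw [inducedMetric_graph hν hB hU hu hf hz]
  apply Matrix.inv_eq_right_inv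
  ext i j
  have hW : 1 + gradSq u z ≠ 0 := by have := gradSq_nonneg u z; positivity
  set p : Fin m → ℝ := fun i => dirDeriv (stdVec i) u z with hp
  have hsum : ∑ k, p k * graphCoeff u k j z = p j - p j * gradSq u z / (1 + gradSq u z) := by
    have : ∀ k, p k * graphCoeff u k j z
        = (if k = j then p k else 0) - p j / (1 + gradSq u z) * dirDeriv (stdVec k) u z ^ 2 := by
      intro k
      simp only [graphCoeff, hp]
      split_ifs <;> ring
    simp only [this, Finset.sum_sub_distrib, ← Finset.mul_sum]
    simp [gradSq]
    ring
  have hmul : ((1 + Matrix.replicateCol Unit p * Matrix.replicateRow Unit p) *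
      (Matrix.of fun i j => graphCoeff u i j z) : Matrix (Fin m) (Fin m) ℝ) i j
      = graphCoeff u i j z + p i * ∑ k, p k * graphCoeff u k j z := by
    rw [add_mul, one_mul, Matrix.add_apply, Matrix.mul_apply]
    simp [Matrix.mul_apply, Finset.mul_sum, mul_assoc]
  rw [hmul, hsum, graphCoeff, Matrix.one_apply]
  simp only [hp]
  field_simp
  ring

/-- The normal component of the Laplace–Beltrami operator of a graph: only the second order terms
survive the pairing with the normal `ν - Du`. -/
theorem inner_laplaceBeltrami_graph (hν : ‖ν‖ = 1) (hB : ∀ x, ⟪B x, ν⟫_ℝ = 0)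
    (hU : IsOpen U) (hu : ContDiffOn ℝ ∞ u U)
    (hf : ∀ z ∈ U, f z = B z + u z • ν) {z : E m} (hz : z ∈ U) {N : E (m + 1)}
    (hNν : ⟪N, ν⟫_ℝ = 1) (hN : ∀ x, ⟪N, B x⟫_ℝ = - dirDeriv x u z) :
    ⟪N, laplaceBeltrami f f z⟫_ℝ =
      ∑ i, ∑ j, graphCoeff u i j z * dirDeriv (stdVec i) (dirDeriv (stdVec j) u) z := by
  have hW : ∀ y, 0 < 1 + gradSq u y := fun y => by have := gradSq_nonneg u y; positivity
  have hs : 0 < √(1 + gradSq u z) := Real.sqrt_pos.mpr (hW z)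
  have hnear := hU.mem_nhds hz
  have hcoef : ∀ i j, DifferentiableAt ℝ (fun y => √(1 + gradSq u y) * graphCoeff u i j y) z := by
    intro i j
    refine DifferentiableAt.mul (DifferentiableAt.sqrt ?_ (hW z).ne') ?_
    · exact (differentiableAt_of_contDiffOn hU (gradSq_contDiffOn hU hu) hz).const_add 1
    · exact differentiableAt_of_contDiffOn hU (graphCoeff_contDiffOn hU hu i j) hz
  have hp : ∀ j : Fin m, DifferentiableAt ℝ (dirDeriv (stdVec j) u) z := fun j =>
    differentiableAt_of_contDiffOn hU (dirDeriv_contDiffOn hU hu _) hz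
  have key : ∀ i : Fin m, ⟪N, fderiv ℝ (fun y => √(inducedMetric f y).det •
      ∑ j : Fin m, (inducedMetric f y)⁻¹ i j • fderiv ℝ f y (EuclideanSpace.single j 1))
      z (EuclideanSpace.single i 1)⟫_ℝ
      = ∑ j, √(1 + gradSq u z) * graphCoeff u i j z *
          dirDeriv (stdVec i) (dirDeriv (stdVec j) u) z := by
    intro i
    have hev : (fun y => √(inducedMetric f y).det •
      ∑ j : Fin m, (inducedMetric f y)⁻¹ i j • fderiv ℝ f y (EuclideanSpace.single j 1)) =ᶠ[𝓝 z]
      fun y => ∑ j : Fin m, (√(1 + gradSq u y) * graphCoeff u i j y) •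
        (B (stdVec j) + dirDeriv (stdVec j) u y • ν) := by
      filter_upwards [hnear] with y hy
      rw [det_inducedMetric_graph hν hB hU hu hf hy, inv_inducedMetric_graph hν hB hU hu hf hy]
      simp only [fderiv_graph hU hu hf hy, Finset.smul_sum, smul_smul, Matrix.of_apply]
    have hdiff : DifferentiableAt ℝ (fun y => ∑ j : Fin m,
        (√(1 + gradSq u y) * graphCoeff u i j y) •
        (B (stdVec j) + dirDeriv (stdVec j) u y • ν)) z :=
      DifferentiableAt.fun_sum fun j _ =>
        (hcoef i j).smul (((hp j).smul_const ν).const_add _)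
    rw [hev.fderiv_eq]
    have h1 : ∀ x : E (m + 1), ⟪N, x⟫_ℝ = innerSL ℝ N x := fun x => by simp
    rw [h1, ← ContinuousLinearMap.comp_apply,
      ← ((innerSL ℝ N).hasFDerivAt.comp z hdiff.hasFDerivAt).fderiv]
    have h2 : (innerSL ℝ N ∘ fun y => ∑ j : Fin m,
        (√(1 + gradSq u y) * graphCoeff u i j y) •
        (B (stdVec j) + dirDeriv (stdVec j) u y • ν)) = fun y => ∑ j : Fin m,
        (√(1 + gradSq u y) * graphCoeff u i j y) *
          (dirDeriv (stdVec j) u y - dirDeriv (stdVec j) u z) := by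
      funext y
      simp only [Function.comp, innerSL_apply_apply, inner_sum, inner_smul_right, inner_add_right,
        hNν, hN]
      refine Finset.sum_congr rfl fun j _ => ?_
      ring
    rw [h2]
    change dirDeriv (stdVec i) _ z = _
    rw [dirDeriv_sum _ (fun j _ => (hcoef i j).fun_mul ((hp j).sub_const _))]
    refine Finset.sum_congr rfl fun j _ => ?_
    rw [dirDeriv_mul (hcoef i j) ((hp j).sub_const _), dirDeriv_sub_const, sub_self, zero_mul,
      add_zero]
  rw [laplaceBeltrami, inner_smul_right, inner_sum, det_inducedMetric_graph hν hB hU hu hf hz]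
  simp only [key]
  rw [Finset.mul_sum]
  refine Finset.sum_congr rfl fun i _ => ?_
  rw [Finset.mul_sum]
  refine Finset.sum_congr rfl fun j _ => ?_
  field_simp

end Graph

/-! ### The self-shrinker equation of a graph, at a point with horizontal tangent plane -/

section GraphEquation

variable {m : ℕ} {U : Set (E m)} {u : E m → ℝ}

/-- The self-shrinker equation of the graph of `u`, in nondivergence form:
`∑ gⁱʲ uᵢⱼ = (⟨z, Du⟩ - u) / 2`. -/
def GraphEquation (u : E m → ℝ) (z : E m) : Prop :=
  ∑ i, ∑ j, graphCoeff u i j z * dirDeriv (stdVec i) (dirDeriv (stdVec j) u) z =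
    (dirDeriv z u z - u z) / 2

theorem graphCoeff_of_horizontal {y : E m} (h0 : ∀ x, dirDeriv x u y = 0) (i j : Fin m) :
    graphCoeff u i j y = if i = j then 1 else 0 := by
  simp [graphCoeff, h0]

theorem dirDeriv_graphCoeff_of_horizontal (hU : IsOpen U) (hu : ContDiffOn ℝ ∞ u U) {y : E m}
    (hy : y ∈ U) (h0 : ∀ x, dirDeriv x u y = 0) (i j : Fin m) (c : E m) :
    dirDeriv c (graphCoeff u i j) y = 0 := by
  have hi := differentiableAt_of_contDiffOn hU (dirDeriv_contDiffOn hU hu (stdVec i)) hy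
  have hq : DifferentiableAt ℝ (fun z => dirDeriv (stdVec j) u z / (1 + gradSq u z)) y :=
    differentiableAt_of_contDiffOn hU ((dirDeriv_contDiffOn hU hu _).div
      (contDiffOn_const.add (gradSq_contDiffOn hU hu))
      fun z _ => by have := gradSq_nonneg u z; positivity) hy
  have : graphCoeff u i j = fun z => (if i = j then (1 : ℝ) else 0) -
      dirDeriv (stdVec i) u z * (dirDeriv (stdVec j) u z / (1 + gradSq u z)) := by
    funext z; rw [graphCoeff, mul_div_assoc]
  rw [this, dirDeriv_const_sub, dirDeriv_mul hi hq]
  simp [h0]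

theorem laplacian_of_horizontal {y : E m} (h0 : ∀ x, dirDeriv x u y = 0)
    (heq : GraphEquation u y) :
    ∑ i, dirDeriv (stdVec i) (dirDeriv (stdVec i) u) y = -(1 / 2) * u y := by
  have := heq
  simp only [GraphEquation, graphCoeff_of_horizontal h0, h0] at this
  simp at this
  linarith

/-- The derivatives of a solution of the self-shrinker equation solve the linearized equation. It
has no zeroth order term, since `D_c (⟨z, Du⟩ - u) = ⟨z, D (D_c u)⟩`, and no first order term from
the coefficients, whose derivatives vanish where `Du = 0`. -/
theorem laplacian_dirDeriv_of_horizontal (hU : IsOpen U) (hu : ContDiffOn ℝ ∞ u U) {y : E m}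
    (hy : y ∈ U) (h0 : ∀ x, dirDeriv x u y = 0) (heq : ∀ z ∈ U, GraphEquation u z) (c : E m) :
    ∑ i, dirDeriv (stdVec i) (dirDeriv (stdVec i) (dirDeriv c u)) y =
      1 / 2 * dirDeriv y (dirDeriv c u) y := by
  have hnear := hU.mem_nhds hy
  have hcoef : ∀ i j, DifferentiableAt ℝ (graphCoeff u i j) y := fun i j =>
    differentiableAt_of_contDiffOn hU (graphCoeff_contDiffOn hU hu i j) hy
  have hD : ∀ a, ContDiffOn ℝ ∞ (dirDeriv a u) U := fun a => dirDeriv_contDiffOn hU hu a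
  have hDD : ∀ a b, DifferentiableAt ℝ (dirDeriv a (dirDeriv b u)) y := fun a b =>
    differentiableAt_of_contDiffOn hU (dirDeriv_contDiffOn hU (hD b) a) hy
  have hfd : DifferentiableAt ℝ (fderiv ℝ u) y :=
    differentiableAt_of_contDiffOn hU (hu.fderiv_of_isOpen hU (by simp)) hy
  have hud := differentiableAt_of_contDiffOn hU hu hy
  have heq' : (fun z => ∑ i, ∑ j, graphCoeff u i j z *
      dirDeriv (stdVec i) (dirDeriv (stdVec j) u) z) =ᶠ[𝓝 y]
      fun z => (1 / 2 : ℝ) * (fderiv ℝ u z z - u z) := by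
    filter_upwards [hnear] with z hz
    have := heq z hz
    rw [GraphEquation] at this
    rw [this, dirDeriv]; ring
  have hR : dirDeriv c (fun z => (1 / 2 : ℝ) * (fderiv ℝ u z z - u z)) y
      = 1 / 2 * dirDeriv y (dirDeriv c u) y := by
    have hzz : DifferentiableAt ℝ (fun z => fderiv ℝ u z z) y := hfd.clm_apply differentiableAt_id
    rw [dirDeriv_const_mul _ (hzz.fun_sub hud), dirDeriv_sub hzz hud, dirDeriv_comm hU hu hy y c,
      dirDeriv_dirDeriv hfd]
    simp only [dirDeriv]
    rw [fderiv_clm_apply hfd differentiableAt_fun_id]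
    simp
  have hL : dirDeriv c (fun z => ∑ i, ∑ j, graphCoeff u i j z *
      dirDeriv (stdVec i) (dirDeriv (stdVec j) u) z) y
      = ∑ i, dirDeriv (stdVec i) (dirDeriv (stdVec i) (dirDeriv c u)) y := by
    rw [dirDeriv_sum _ (fun i _ => DifferentiableAt.fun_sum fun j _ =>
      (hcoef i j).fun_mul (hDD _ _))]
    refine Finset.sum_congr rfl fun i _ => ?_
    rw [dirDeriv_sum _ (fun j _ => (hcoef i j).fun_mul (hDD _ _))]
    simp only [dirDeriv_mul (hcoef i _) (hDD _ _), graphCoeff_of_horizontal h0,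
      dirDeriv_graphCoeff_of_horizontal hU hu hy h0]
    simp only [mul_zero, add_zero, ite_mul, one_mul, zero_mul, Finset.sum_ite_eq,
      Finset.mem_univ, if_true]
    rw [dirDeriv_comm hU (hD _) hy]
    refine dirDeriv_congr ?_ _
    filter_upwards [hnear] with z hz using dirDeriv_comm hU hu hz _ _
  rw [← hL, ← hR]
  exact dirDeriv_congr heq' c

variable {B : E m →ₗᵢ[ℝ] E (m + 1)} {ν : E (m + 1)} {f : E m → E (m + 1)}

theorem dirDeriv_comp_graph (hU : IsOpen U) (hu : ContDiffOn ℝ ∞ u U)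
    (hf : ∀ z ∈ U, f z = B z + u z • ν) {z : E m} (hz : z ∈ U) {g : E (m + 1) → ℝ}
    (hg : DifferentiableAt ℝ g (f z)) (x : E m) :
    dirDeriv x (fun w => g (f w)) z =
      dirDeriv (B x) g (f z) + dirDeriv x u z * dirDeriv ν g (f z) := by
  have hfd : DifferentiableAt ℝ f z := by
    have h1 : f =ᶠ[𝓝 z] fun y => B y + u y • ν := by
      filter_upwards [hU.mem_nhds hz] with y hy using hf y hy
    have hd := differentiableAt_of_contDiffOn hU hu hz
    have hB : DifferentiableAt ℝ B z := B.toContinuousLinearMap.differentiableAt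
    exact h1.differentiableAt_iff.mpr (hB.add (hd.smul_const ν))
  have h2 : fderiv ℝ (fun w => g (f w)) z = (fderiv ℝ g (f z)).comp (fderiv ℝ f z) :=
    fderiv_comp z hg hfd
  simp only [dirDeriv, h2, ContinuousLinearMap.comp_apply]
  rw [fderiv_graph hU hu hf hz]
  simp [dirDeriv]

/-- The trace of the Hessian of `h` over the image of `B`, minus half of the derivative in the
direction of the position vector. Along a self-shrinker with tangent space `range B` at `x` it is
the value at `x` of the drift Laplacian `Δ_g - ⟨x, ∇ ·⟩ / 2` on the restriction of `h`. -/
noncomputable def driftLaplacian (B : E m →ₗᵢ[ℝ] E (m + 1)) (h : E (m + 1) → ℝ)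
    (x : E (m + 1)) : ℝ :=
  ∑ i, dirDeriv (B (stdVec i)) (dirDeriv (B (stdVec i)) h) x - 1 / 2 * dirDeriv x h x

theorem driftLaplacian_comp_graph (hU : IsOpen U) (hu : ContDiffOn ℝ ∞ u U)
    (hf : ∀ z ∈ U, f z = B z + u z • ν) {y : E m} (hy : y ∈ U)
    (h0 : ∀ x, dirDeriv x u y = 0) (heq : GraphEquation u y) {h : E (m + 1) → ℝ}
    (hh : ContDiff ℝ ∞ h) :
    ∑ i, dirDeriv (stdVec i) (dirDeriv (stdVec i) (fun w => h (f w))) y -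
      1 / 2 * dirDeriv y (fun w => h (f w)) y = driftLaplacian B h (f y) := by
  have hD : ∀ a, ContDiff ℝ ∞ (dirDeriv a h) := fun a =>
    contDiffOn_univ.mp (dirDeriv_contDiffOn isOpen_univ hh.contDiffOn a)
  have hd : ∀ {g : E (m + 1) → ℝ}, ContDiff ℝ ∞ g → Differentiable ℝ g := fun hg =>
    hg.differentiable (by simp)
  have hfsm : ContDiffOn ℝ ∞ f U :=
    (B.toContinuousLinearMap.contDiff.contDiffOn.add (hu.smul contDiffOn_const)).congr hf
  have hsecond : ∀ i : Fin m, dirDeriv (stdVec i) (dirDeriv (stdVec i) (fun w => h (f w))) y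
      = dirDeriv (B (stdVec i)) (dirDeriv (B (stdVec i)) h) (f y) +
        dirDeriv (stdVec i) (dirDeriv (stdVec i) u) y * dirDeriv ν h (f y) := by
    intro i
    have h1 : dirDeriv (stdVec i) (fun w => h (f w)) =ᶠ[𝓝 y] fun w =>
        dirDeriv (B (stdVec i)) h (f w) + dirDeriv (stdVec i) u w * dirDeriv ν h (f w) := by
      filter_upwards [hU.mem_nhds hy] with w hw
      exact dirDeriv_comp_graph hU hu hf hw (hd hh _) _
    have e1 : ∀ a, DifferentiableAt ℝ (fun w => dirDeriv a h (f w)) y := fun a =>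
      differentiableAt_of_contDiffOn hU ((hD a).comp_contDiffOn hfsm) hy
    have e2 := differentiableAt_of_contDiffOn hU (dirDeriv_contDiffOn hU hu (stdVec i)) hy
    rw [dirDeriv_congr h1, dirDeriv_add (e1 _) (e2.fun_mul (e1 _)), dirDeriv_mul e2 (e1 _),
      dirDeriv_comp_graph hU hu hf hy (hd (hD _) _)]
    simp [h0, mul_comm]
  simp only [hsecond, Finset.sum_add_distrib, ← Finset.sum_mul, laplacian_of_horizontal h0 heq,
    dirDeriv_comp_graph hU hu hf hy (hd hh _), h0, driftLaplacian]
  have hpos : dirDeriv (f y) h (f y) = dirDeriv (B y) h (f y) + u y * dirDeriv ν h (f y) := by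
    conv_lhs => rw [dirDeriv, hf y hy]
    rw [map_add, map_smul, ← hf y hy]; rfl
  rw [hpos]
  ring

/-- The function `φ = c₀ - D_c u` is annihilated by the linearized operator, so a test function
touching it from below at a point with horizontal tangent plane has nonpositive drift
Laplacian. -/
theorem driftLaplacian_nonpos_of_isLocalMin (hU : IsOpen U) (hu : ContDiffOn ℝ ∞ u U)
    (hf : ∀ z ∈ U, f z = B z + u z • ν) {y : E m} (hy : y ∈ U)
    (h0 : ∀ x, dirDeriv x u y = 0) (heq : ∀ z ∈ U, GraphEquation u z) {h : E (m + 1) → ℝ}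
    (hh : ContDiff ℝ ∞ h) (c₀ : ℝ) (c : E m)
    (hmin : IsLocalMin (fun z => (c₀ - dirDeriv c u z) - h (f z)) y) :
    driftLaplacian B h (f y) ≤ 0 := by
  have hfsm : ContDiffOn ℝ ∞ f U :=
    (B.toContinuousLinearMap.contDiff.contDiffOn.add (hu.smul contDiffOn_const)).congr hf
  have hφ : ContDiffOn ℝ ∞ (fun z => c₀ - dirDeriv c u z) U :=
    contDiffOn_const.sub (dirDeriv_contDiffOn hU hu c)
  have hH : ContDiffOn ℝ ∞ (fun z => h (f z)) U := hh.comp_contDiffOn hfsm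
  have hfirst : ∀ a, ∀ z ∈ U, dirDeriv a (fun z => (c₀ - dirDeriv c u z) - h (f z)) z =
      (0 - dirDeriv a (dirDeriv c u) z) - dirDeriv a (fun w => h (f w)) z := by
    intro a z hz
    rw [dirDeriv_sub (differentiableAt_of_contDiffOn hU hφ hz)
      (differentiableAt_of_contDiffOn hU hH hz), dirDeriv_const_sub, zero_sub]
  have hsecond : ∀ a, dirDeriv a (dirDeriv a (fun z => (c₀ - dirDeriv c u z) - h (f z))) y =
      - dirDeriv a (dirDeriv a (dirDeriv c u)) y -
        dirDeriv a (dirDeriv a (fun w => h (f w))) y := by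
    intro a
    have h1 : dirDeriv a (fun z => (c₀ - dirDeriv c u z) - h (f z)) =ᶠ[𝓝 y] fun z =>
        (0 - dirDeriv a (dirDeriv c u) z) - dirDeriv a (fun w => h (f w)) z := by
      filter_upwards [hU.mem_nhds hy] with z hz using hfirst a z hz
    have d1 := dirDeriv_contDiffOn hU (dirDeriv_contDiffOn hU hu c) a
    rw [dirDeriv_congr h1, dirDeriv_sub ((differentiableAt_of_contDiffOn hU d1 hy).const_sub 0)
      (differentiableAt_of_contDiffOn hU (dirDeriv_contDiffOn hU hH a) hy), dirDeriv_const_sub]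
  have hsum : 0 ≤ ∑ i : Fin m, dirDeriv (stdVec i) (dirDeriv (stdVec i)
      (fun z => (c₀ - dirDeriv c u z) - h (f z))) y :=
    Finset.sum_nonneg fun i _ =>
      dirDeriv_dirDeriv_nonneg_of_isLocalMin hU (hφ.sub hH) hy hmin _
  have hgrad := dirDeriv_eq_zero_of_isLocalMin hmin y
  rw [hfirst y y hy] at hgrad
  simp only [hsecond, Finset.sum_sub_distrib, Finset.sum_neg_distrib,
    laplacian_dirDeriv_of_horizontal hU hu hy h0 heq c] at hsum
  rw [← driftLaplacian_comp_graph hU hu hf hy h0 (heq y hy) hh]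
  linarith

/-- If the normal component `φ / √(1 + |Du|²)` of a translation is a nonzero constant, the second
fundamental form vanishes: compare the Laplacians of both sides of `φ² = c₀² (1 + |Du|²)`. -/
theorem hessian_eq_zero_of_sq_eq (hU : IsOpen U) (hu : ContDiffOn ℝ ∞ u U) {y : E m} (hy : y ∈ U)
    (h0 : ∀ x, dirDeriv x u y = 0) (heq : ∀ z ∈ U, GraphEquation u z) {c₀ : ℝ} (hc₀ : c₀ ≠ 0)
    (c : E m) (hmin : IsLocalMin (fun z => c₀ - dirDeriv c u z) y)
    (hsq : ∀ᶠ z in 𝓝 y, (c₀ - dirDeriv c u z) ^ 2 = c₀ ^ 2 * (1 + gradSq u z)) (a b : E m) :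
    dirDeriv a (dirDeriv b u) y = 0 := by
  have hφ : ContDiffOn ℝ ∞ (fun z => c₀ - dirDeriv c u z) U :=
    contDiffOn_const.sub (dirDeriv_contDiffOn hU hu c)
  have hcoord : ∀ i k : Fin m, dirDeriv (stdVec i) (dirDeriv (stdVec k) u) y = 0 := by
    have hφ2 : ∀ a, dirDeriv a (dirDeriv a (fun z => c₀ - dirDeriv c u z)) y =
        - dirDeriv a (dirDeriv a (dirDeriv c u)) y := by
      intro a
      have h1 : dirDeriv a (fun z => c₀ - dirDeriv c u z) =
          fun z => 0 - dirDeriv a (dirDeriv c u) z := by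
        funext z; rw [dirDeriv_const_sub, zero_sub]
      rw [h1, dirDeriv_const_sub]
    have hgrad := dirDeriv_eq_zero_of_isLocalMin hmin
    have hL : ∑ i : Fin m, dirDeriv (stdVec i) (dirDeriv (stdVec i)
        (fun z => (c₀ - dirDeriv c u z) ^ 2)) y = 0 := by
      have hy' := hgrad y
      rw [dirDeriv_const_sub] at hy'
      simp only [dirDeriv_dirDeriv_sq hU hφ hy, hgrad, hφ2, mul_neg]
      rw [Finset.sum_congr rfl fun i _ => by rw [zero_pow two_ne_zero, mul_zero, zero_add]]
      rw [Finset.sum_neg_distrib, ← Finset.mul_sum,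
        laplacian_dirDeriv_of_horizontal hU hu hy h0 heq c, neg_eq_zero.mp hy']
      simp
    have hR : ∀ i : Fin m, dirDeriv (stdVec i) (dirDeriv (stdVec i)
        (fun z => (c₀ - dirDeriv c u z) ^ 2)) y = c₀ ^ 2 * ∑ k,
          2 * dirDeriv (stdVec i) (dirDeriv (stdVec k) u) y ^ 2 := by
      intro i
      have hp : ∀ k : Fin m, ContDiffOn ℝ ∞ (fun z => dirDeriv (stdVec k) u z ^ 2) U := fun k =>
        (dirDeriv_contDiffOn hU hu _).pow 2
      have h1 : dirDeriv (stdVec i) (fun z => (c₀ - dirDeriv c u z) ^ 2) =ᶠ[𝓝 y]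
          fun z => c₀ ^ 2 * ∑ k, dirDeriv (stdVec i) (fun z => dirDeriv (stdVec k) u z ^ 2) z := by
        filter_upwards [hsq.eventually_nhds, hU.mem_nhds hy] with z hz hzU
        have hg := differentiableAt_of_contDiffOn hU (gradSq_contDiffOn hU hu) hzU
        rw [dirDeriv_congr hz, dirDeriv_const_mul _ (hg.const_add 1)]
        rw [← dirDeriv_sum _ fun k _ => differentiableAt_of_contDiffOn hU (hp k) hzU,
          dirDeriv_const_add]
        rfl
      have d : ∀ k : Fin m, DifferentiableAt ℝ
          (dirDeriv (stdVec i) (fun z => dirDeriv (stdVec k) u z ^ 2)) y := fun k =>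
        differentiableAt_of_contDiffOn hU (dirDeriv_contDiffOn hU (hp k) _) hy
      rw [dirDeriv_congr h1, dirDeriv_const_mul _ (DifferentiableAt.fun_sum fun k _ => d k),
        dirDeriv_sum _ fun k _ => d k]
      congr 1
      refine Finset.sum_congr rfl fun k _ => ?_
      rw [dirDeriv_dirDeriv_sq hU (dirDeriv_contDiffOn hU hu _) hy, h0]
      ring
    simp only [hR] at hL
    rw [← Finset.mul_sum] at hL
    have hz := (mul_eq_zero.mp hL).resolve_left (pow_ne_zero 2 hc₀)
    intro i k
    rw [Finset.sum_eq_zero_iff_of_nonneg fun i _ => Finset.sum_nonneg fun k _ => by positivity]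
      at hz
    have hz' := hz i (Finset.mem_univ i)
    rw [Finset.sum_eq_zero_iff_of_nonneg fun k _ => by positivity] at hz'
    have := hz' k (Finset.mem_univ k)
    simpa using this
  have h1 : ∀ k : Fin m, dirDeriv (stdVec k) (dirDeriv b u) y = 0 := by
    intro k
    rw [dirDeriv_comm hU hu hy, ← sum_smul_dirDeriv_stdVec]
    refine Finset.sum_eq_zero fun i _ => ?_
    rw [hcoord, smul_zero]
  rw [← sum_smul_dirDeriv_stdVec]
  exact Finset.sum_eq_zero fun i _ => by rw [h1, smul_zero]

end GraphEquation

/-! ### Charts adapted to an immersion -/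

section Charts

variable {d k : ℕ} {M : Type*} [TopologicalSpace M] [ChartedSpace (E d) M]

theorem contDiffOn_comp_chart_symm {F : M → E k} (hF : ContMDiff (𝓡 d) 𝓘(ℝ, E k) ∞ F)
    {e : OpenPartialHomeomorph M (E d)} (he : e ∈ IsManifold.maximalAtlas (𝓡 d) ∞ M) :
    ContDiffOn ℝ ∞ (F ∘ e.symm) e.target :=
  contMDiffOn_iff_contDiffOn.mp
    (hF.comp_contMDiffOn (contMDiffOn_symm_of_mem_maximalAtlas he))

theorem mfderiv_eq_fderiv_comp_chart {F : M → E k} (hF : ContMDiff (𝓡 d) 𝓘(ℝ, E k) ∞ F)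
    {e : OpenPartialHomeomorph M (E d)} (he : e ∈ IsManifold.maximalAtlas (𝓡 d) ∞ M)
    {p : M} (hp : p ∈ e.source) :
    ∃ A : E d →L[ℝ] E d, Function.Bijective A ∧
      (mfderiv (𝓡 d) 𝓘(ℝ, E k) F p : E d →L[ℝ] E k) = (fderiv ℝ (F ∘ e.symm) (e p)).comp A := by
  have hMD : e.MDifferentiable (𝓡 d) (𝓡 d) :=
    ⟨(contMDiffOn_of_mem_maximalAtlas he).mdifferentiableOn (by simp),
      (contMDiffOn_symm_of_mem_maximalAtlas he).mdifferentiableOn (by simp)⟩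
  refine ⟨mfderiv (𝓡 d) (𝓡 d) e p, hMD.mfderiv_bijective hp, ?_⟩
  have hev : F =ᶠ[𝓝 p] (F ∘ e.symm) ∘ e := by
    filter_upwards [e.open_source.mem_nhds hp] with q hq
    simp [e.left_inv hq]
  have hd : DifferentiableAt ℝ (F ∘ e.symm) (e p) :=
    differentiableAt_of_contDiffOn e.open_target (contDiffOn_comp_chart_symm hF he)
      (e.map_source hp)
  rw [hev.mfderiv_eq, mfderiv_comp p hd.mdifferentiableAt (hMD.mdifferentiableAt hp),
    mfderiv_eq_fderiv]
  rfl

theorem tangentImage_eq_range_fderiv {F : M → E k} (hF : ContMDiff (𝓡 d) 𝓘(ℝ, E k) ∞ F)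
    {e : OpenPartialHomeomorph M (E d)} (he : e ∈ IsManifold.maximalAtlas (𝓡 d) ∞ M)
    {p : M} (hp : p ∈ e.source) :
    tangentImage (n := d) F p = LinearMap.range (fderiv ℝ (F ∘ e.symm) (e p)).toLinearMap := by
  obtain ⟨A, hA, h⟩ := mfderiv_eq_fderiv_comp_chart hF he hp
  rw [tangentImage, h]
  ext x
  simp only [LinearMap.mem_range, ContinuousLinearMap.coe_coe]
  constructor
  · rintro ⟨y, rfl⟩; exact ⟨_, rfl⟩
  · rintro ⟨y, rfl⟩
    obtain ⟨w, rfl⟩ := hA.2 y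
    exact ⟨w, rfl⟩

theorem injective_mfderiv_iff {F : M → E k} (hF : ContMDiff (𝓡 d) 𝓘(ℝ, E k) ∞ F)
    {e : OpenPartialHomeomorph M (E d)} (he : e ∈ IsManifold.maximalAtlas (𝓡 d) ∞ M)
    {p : M} (hp : p ∈ e.source) :
    Function.Injective (mfderiv (𝓡 d) 𝓘(ℝ, E k) F p) ↔
      Function.Injective (fderiv ℝ (F ∘ e.symm) (e p)) := by
  obtain ⟨A, hA, h⟩ := mfderiv_eq_fderiv_comp_chart hF he hp
  have : Function.Injective (mfderiv (𝓡 d) 𝓘(ℝ, E k) F p) ↔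
      Function.Injective ((fderiv ℝ (F ∘ e.symm) (e p)) ∘ A) := by
    rw [← ContinuousLinearMap.coe_comp, ← h]; rfl
  rw [this]
  exact Function.Injective.of_comp_iff' _ hA

/-- Inverse function theorem: a smooth map to `ℝᵈ` with injective differential at `p` is a chart
near `p`. -/
theorem exists_chart_eq [IsManifold (𝓡 d) ∞ M] {A : M → E d} (hA : ContMDiff (𝓡 d) 𝓘(ℝ, E d) ∞ A) {p : M}
    (hinj : Function.Injective (mfderiv (𝓡 d) 𝓘(ℝ, E d) A p)) :
    ∃ e ∈ IsManifold.maximalAtlas (𝓡 d) ∞ M, p ∈ e.source ∧ ∀ q ∈ e.source, e q = A q := by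
  set e₁ := chartAt (E d) p with he₁
  have hat : e₁ ∈ IsManifold.maximalAtlas (𝓡 d) ∞ M := IsManifold.chart_mem_maximalAtlas p
  have hp : p ∈ e₁.source := mem_chart_source _ p
  set g : E d → E d := A ∘ e₁.symm with hg
  have hgs : ContDiffOn ℝ ∞ g e₁.target := contDiffOn_comp_chart_symm hA hat
  have hp' := e₁.map_source hp
  have hgp : ContDiffAt ℝ ∞ g (e₁ p) := hgs.contDiffAt (e₁.open_target.mem_nhds hp')
  have hLinj := (injective_mfderiv_iff hA hat hp).mp hinj
  let L : E d ≃L[ℝ] E d :=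
    (LinearEquiv.ofInjectiveEndo (fderiv ℝ g (e₁ p)).toLinearMap hLinj).toContinuousLinearEquiv
  have hL : HasFDerivAt g (L : E d →L[ℝ] E d) (e₁ p) := by
    have : (L : E d →L[ℝ] E d) = fderiv ℝ g (e₁ p) := by ext x; rfl
    rw [this]
    exact (hgp.differentiableAt (by simp)).hasFDerivAt
  set Ψ := hgp.toOpenPartialHomeomorph g hL (by simp) with hΨ
  have hΨc : (Ψ : E d → E d) = g := hgp.toOpenPartialHomeomorph_coe hL (by simp)
  -- the differential stays invertible on an open neighbourhood
  set W : Set (E d) := e₁.target ∩ fderiv ℝ g ⁻¹'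
    (range ((↑) : (E d ≃L[ℝ] E d) → (E d →L[ℝ] E d))) with hW
  have hWo : IsOpen W := ContinuousOn.isOpen_inter_preimage
    (hgs.fderiv_of_isOpen (m := ∞) e₁.open_target (by simp)).continuousOn e₁.open_target
    ContinuousLinearEquiv.isOpen
  have hpW : e₁ p ∈ W := ⟨hp', L, by rw [hL.fderiv]⟩
  set Ψ' := Ψ.restrOpen W hWo with hΨ'
  have hΨ's : Ψ'.source = Ψ.source ∩ W := Ψ.restrOpen_source W hWo
  have hΨ'c : (Ψ' : E d → E d) = g := hΨc
  have hsymm : ContDiffOn ℝ ∞ Ψ'.symm Ψ'.target := by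
    intro y hy
    have hy' : Ψ'.symm y ∈ W := by
      have := Ψ'.map_target hy
      rw [hΨ's] at this
      exact this.2
    obtain ⟨L', hL'⟩ := hy'.2
    have hgy : ContDiffAt ℝ ∞ g (Ψ'.symm y) := hgs.contDiffAt (e₁.open_target.mem_nhds hy'.1)
    refine (Ψ'.contDiffAt_symm (f₀' := L') hy ?_ ?_).contDiffWithinAt
    · rw [hΨ'c, hL']
      exact (hgy.differentiableAt (by simp)).hasFDerivAt
    · rw [hΨ'c]; exact hgy
  have hcoe : ∀ q ∈ (e₁ ≫ₕ Ψ').source, (e₁ ≫ₕ Ψ') q = A q := by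
    intro q hq
    rw [OpenPartialHomeomorph.trans_source] at hq
    rw [OpenPartialHomeomorph.coe_trans, Function.comp_apply, hΨ'c, hg, Function.comp_apply,
      e₁.left_inv hq.1]
  refine ⟨e₁ ≫ₕ Ψ', OpenPartialHomeomorph.mem_maximalAtlas_of_contMDiffOn _ ?_ ?_, ?_, hcoe⟩
  · exact hA.contMDiffOn.congr hcoe
  · rw [OpenPartialHomeomorph.trans_symm_eq_symm_trans_symm, OpenPartialHomeomorph.coe_trans]
    refine (contMDiffOn_symm_of_mem_maximalAtlas hat).comp
      ((contMDiffOn_iff_contDiffOn.mpr hsymm).mono ?_) ?_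
    · intro y hy
      rw [OpenPartialHomeomorph.trans_target] at hy
      exact hy.1
    · intro y hy
      rw [OpenPartialHomeomorph.trans_target] at hy
      exact hy.2
  · rw [OpenPartialHomeomorph.trans_source, hΨ's]
    exact ⟨hp, hgp.mem_toOpenPartialHomeomorph_source hL (by simp), hpW⟩

end Charts

section Hyperplanes

variable {m : ℕ} {B : E m →ₗᵢ[ℝ] E (m + 1)} {ν : E (m + 1)}

theorem exists_linearIsometry_range_eq (T : Submodule ℝ (E (m + 1)))
    (hT : Module.finrank ℝ T = m) :
    ∃ B : E m →ₗᵢ[ℝ] E (m + 1), LinearMap.range B.toLinearMap = T := by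
  have b : OrthonormalBasis (Fin m) ℝ T :=
    (stdOrthonormalBasis ℝ T).reindex (finCongr hT)
  refine ⟨T.subtypeₗᵢ.comp b.repr.symm.toLinearIsometry, ?_⟩
  ext x
  simp only [LinearMap.mem_range, LinearIsometry.coe_toLinearMap]
  constructor
  · rintro ⟨y, rfl⟩; exact (b.repr.symm y).2
  · intro hx
    exact ⟨b.repr ⟨x, hx⟩, by simp⟩

theorem exists_linearIsometry_range_eq_of_mem (T : Submodule ℝ (E (m + 1)))
    (hT : Module.finrank ℝ T = m) (i : Fin m) {a : E (m + 1)} (ha : a ∈ T) (hna : ‖a‖ = 1) :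
    ∃ B : E m →ₗᵢ[ℝ] E (m + 1), LinearMap.range B.toLinearMap = T ∧ B (stdVec i) = a := by
  have ho : Orthonormal ℝ (({i} : Set (Fin m)).domRestrict fun _ => (⟨a, ha⟩ : T)) := by
    constructor
    · intro j; simpa using hna
    · intro j l hjl; exact absurd (Subsingleton.elim j l) hjl
  obtain ⟨b, hb⟩ := ho.exists_orthonormalBasis_extension_of_card_eq (by simpa using hT)
  refine ⟨T.subtypeₗᵢ.comp b.repr.symm.toLinearIsometry, ?_, ?_⟩
  · ext x
    simp only [LinearMap.mem_range, LinearIsometry.coe_toLinearMap]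
    constructor
    · rintro ⟨y, rfl⟩; exact (b.repr.symm y).2
    · intro hx
      exact ⟨b.repr ⟨x, hx⟩, by simp⟩
  · simp [hb i rfl]

/-- The adjoint of `B`; composed with `B` it is the orthogonal projection to `range B`. -/
noncomputable abbrev adj (B : E m →ₗᵢ[ℝ] E (m + 1)) : E (m + 1) →L[ℝ] E m :=
  ContinuousLinearMap.adjoint B.toContinuousLinearMap

theorem inner_adj (B : E m →ₗᵢ[ℝ] E (m + 1)) (x : E m) (w : E (m + 1)) :
    ⟪x, adj B w⟫_ℝ = ⟪B x, w⟫_ℝ :=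
  ContinuousLinearMap.adjoint_inner_right _ _ _

theorem adj_apply (B : E m →ₗᵢ[ℝ] E (m + 1)) (x : E m) : adj B (B x) = x :=
  ext_inner_left ℝ fun y => by rw [inner_adj, B.inner_map_map]

theorem adj_eq_zero {ν : E (m + 1)} (hB : ∀ x, ⟪B x, ν⟫_ℝ = 0) : adj B ν = 0 :=
  ext_inner_left ℝ fun y => by rw [inner_adj, hB, inner_zero_right]

theorem range_adj_add_normal (hν : ‖ν‖ = 1) (hB : ∀ x, ⟪B x, ν⟫_ℝ = 0) (w : E (m + 1)) :
    w = B (adj B w) + ⟪w, ν⟫_ℝ • ν := by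
  set R := LinearMap.range B.toLinearMap with hR
  have hfr : Module.finrank ℝ R = m := by
    rw [LinearMap.finrank_range_of_inj B.injective]; simp
  have hfro : Module.finrank ℝ Rᗮ = 1 := by
    have := Submodule.finrank_add_finrank_orthogonal R
    rw [hfr, finrank_euclideanSpace_fin] at this
    omega
  have hνR : ν ∈ Rᗮ := by
    rw [Submodule.mem_orthogonal]
    rintro _ ⟨x, rfl⟩
    exact hB x
  have hν0 : (⟨ν, hνR⟩ : Rᗮ) ≠ 0 := by
    intro h
    have : ν = 0 := congrArg Subtype.val h
    simp [this] at hν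
  have hw : w - B (adj B w) ∈ Rᗮ := by
    rw [Submodule.mem_orthogonal]
    rintro _ ⟨x, rfl⟩
    change ⟪B x, w - B (adj B w)⟫_ℝ = 0
    rw [inner_sub_right, B.inner_map_map, inner_adj, sub_self]
  obtain ⟨c, hc⟩ := (finrank_eq_one_iff_of_nonzero' _ hν0).mp hfro ⟨_, hw⟩
  have hc' : c • ν = w - B (adj B w) := congrArg Subtype.val hc
  have hcv : c = ⟪w, ν⟫_ℝ := by
    have := congrArg (fun x => ⟪x, ν⟫_ℝ) hc'
    simpa [inner_smul_left, inner_sub_left, hB, real_inner_self_eq_norm_sq, hν] using this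
  rw [← hcv, hc']
  abel

end Hyperplanes

section GraphChart

variable {m : ℕ} {M : Type*} [TopologicalSpace M] [ChartedSpace (E m) M]
  {F : M → E (m + 1)} {B : E m →ₗᵢ[ℝ] E (m + 1)} {ν : E (m + 1)}
  {e : OpenPartialHomeomorph M (E m)}

/-- The chart `e` presents `F` as a graph over the hyperplane `range B` with unit normal `ν`: the
coordinates of `q` are those of the orthogonal projection of `F q` to the hyperplane. -/
structure IsGraphChart (F : M → E (m + 1)) (B : E m →ₗᵢ[ℝ] E (m + 1)) (ν : E (m + 1))
    (e : OpenPartialHomeomorph M (E m)) : Prop where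
  mem_atlas : e ∈ IsManifold.maximalAtlas (𝓡 m) ∞ M
  norm_normal : ‖ν‖ = 1
  inner_normal : ∀ x, ⟪B x, ν⟫_ℝ = 0
  apply_eq : ∀ q ∈ e.source, e q = adj B (F q)

/-- The height function of a graph chart. -/
noncomputable def height (F : M → E (m + 1)) (ν : E (m + 1))
    (e : OpenPartialHomeomorph M (E m)) (z : E m) : ℝ := ⟪F (e.symm z), ν⟫_ℝ

theorem IsGraphChart.graph (h : IsGraphChart F B ν e) :
    ∀ z ∈ e.target, (F ∘ e.symm) z = B z + height F ν e z • ν := by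
  intro z hz
  have h1 := range_adj_add_normal h.norm_normal h.inner_normal (F (e.symm z))
  rw [← h.apply_eq _ (e.map_target hz), e.right_inv hz] at h1
  exact h1

theorem IsGraphChart.height_contDiffOn (h : IsGraphChart F B ν e)
    (hF : ContMDiff (𝓡 m) 𝓘(ℝ, E (m + 1)) ∞ F) : ContDiffOn ℝ ∞ (height F ν e) e.target :=
  (contDiffOn_comp_chart_symm hF h.mem_atlas).inner ℝ contDiffOn_const

theorem IsGraphChart.tangentImage_eq (h : IsGraphChart F B ν e)
    (hF : ContMDiff (𝓡 m) 𝓘(ℝ, E (m + 1)) ∞ F) {q : M} (hq : q ∈ e.source) (w : E (m + 1)) :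
    w ∈ tangentImage (n := m) F q ↔
      ∃ x, B x + dirDeriv x (height F ν e) (e q) • ν = w := by
  rw [tangentImage_eq_range_fderiv hF h.mem_atlas hq, LinearMap.mem_range]
  simp only [ContinuousLinearMap.coe_coe, fderiv_graph e.open_target (h.height_contDiffOn hF)
    h.graph (e.map_source hq)]

theorem IsGraphChart.mem_orthogonal_iff (h : IsGraphChart F B ν e)
    (hF : ContMDiff (𝓡 m) 𝓘(ℝ, E (m + 1)) ∞ F) {q : M} (hq : q ∈ e.source) (N : E (m + 1)) :
    N ∈ (tangentImage (n := m) F q)ᗮ ↔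
      ∀ x, ⟪N, B x⟫_ℝ = - (dirDeriv x (height F ν e) (e q) * ⟪N, ν⟫_ℝ) := by
  rw [Submodule.mem_orthogonal']
  constructor
  · intro H x
    have := H _ ((h.tangentImage_eq hF hq _).mpr ⟨x, rfl⟩)
    rw [inner_add_right, inner_smul_right] at this
    linarith
  · intro H w hw
    obtain ⟨x, rfl⟩ := (h.tangentImage_eq hF hq _).mp hw
    rw [inner_add_right, inner_smul_right, H]
    ring

/-- Over its own tangent plane, a graph has a horizontal tangent plane. -/
theorem IsGraphChart.dirDeriv_height_eq_zero (h : IsGraphChart F B ν e)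
    (hF : ContMDiff (𝓡 m) 𝓘(ℝ, E (m + 1)) ∞ F) {p : M} (hp : p ∈ e.source)
    (hB : LinearMap.range B.toLinearMap = tangentImage (n := m) F p) (x : E m) :
    dirDeriv x (height F ν e) (e p) = 0 := by
  have hmem : B x + dirDeriv x (height F ν e) (e p) • ν ∈ LinearMap.range B.toLinearMap := by
    rw [hB]; exact (h.tangentImage_eq hF hp _).mpr ⟨x, rfl⟩
  obtain ⟨y, hy⟩ := hmem
  have hy' : B y = B x + dirDeriv x (height F ν e) (e p) • ν := hy
  have := congrArg (fun w => ⟪w, ν⟫_ℝ) hy'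
  simpa [inner_add_left, inner_smul_left, h.inner_normal, real_inner_self_eq_norm_sq,
    h.norm_normal] using this.symm

theorem IsGraphChart.graphEquation (h : IsGraphChart F B ν e)
    (hF : IsProperSelfShrinker (n := m) F) {z : E m} (hz : z ∈ e.target) :
    GraphEquation (height F ν e) z := by
  set u := height F ν e with hu
  have husm := h.height_contDiffOn hF.smooth
  set q := e.symm z with hq
  have hqs : q ∈ e.source := e.map_target hz
  have hqz : e q = z := e.right_inv hz
  have hνν : ⟪ν, ν⟫_ℝ = 1 := by rw [real_inner_self_eq_norm_sq, h.norm_normal]; norm_num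
  -- the normal `ν - Du` of the graph
  set N : E (m + 1) := ν - ∑ k, dirDeriv (stdVec k) u z • B (stdVec k) with hN
  have hNν : ⟪N, ν⟫_ℝ = 1 := by
    rw [hN, inner_sub_left, hνν, sum_inner]
    simp [inner_smul_left, h.inner_normal]
  have hNB : ∀ x, ⟪N, B x⟫_ℝ = - dirDeriv x u z := by
    intro x
    have h1 : ⟪ν, B x⟫_ℝ = 0 := by rw [real_inner_comm]; exact h.inner_normal x
    rw [hN, inner_sub_left, h1, sum_inner, ← sum_smul_dirDeriv_stdVec u x z]
    simp only [inner_smul_left, B.inner_map_map, EuclideanSpace.inner_single_left]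
    simp [mul_comm]
  have hNT : N ∈ (tangentImage (n := m) F q)ᗮ := by
    rw [h.mem_orthogonal_iff hF.smooth hqs]
    intro x
    rw [hNB, hqz, hNν, mul_one]
  have hL := inner_laplaceBeltrami_graph h.norm_normal h.inner_normal e.open_target husm h.graph
    hz hNν hNB
  have hS := hF.shrinker e h.mem_atlas q hqs
  rw [hqz] at hS
  have hproj : ⟪N, normalPosition (n := m) F q⟫_ℝ = ⟪N, F q⟫_ℝ := by
    rw [normalPosition, ← Submodule.inner_starProjection_left_eq_right,
      Submodule.starProjection_eq_self_iff.mpr hNT]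
  have hpos : F q = B z + u z • ν := h.graph z hz
  rw [hS, inner_smul_right, hproj, hpos, inner_add_right, inner_smul_right, hNB, hNν] at hL
  rw [GraphEquation, ← hL]
  ring

theorem finrank_tangentImage (hF : IsProperSelfShrinker (n := m) F) (p : M) :
    Module.finrank ℝ (tangentImage (n := m) F p) = m := by
  have key : ∀ L : E m →L[ℝ] E (m + 1), Function.Injective L →
      Module.finrank ℝ (LinearMap.range L.toLinearMap) = m := fun L hL => by
    rw [LinearMap.finrank_range_of_inj (f := L.toLinearMap) hL, finrank_euclideanSpace_fin]
  exact key _ (hF.immersion p)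

theorem exists_isGraphChart [IsManifold (𝓡 m) ∞ M] (hF : IsProperSelfShrinker (n := m) F) {p : M}
    (hB : LinearMap.range B.toLinearMap = tangentImage (n := m) F p) (hν : ‖ν‖ = 1)
    (hνp : ν ∈ (tangentImage (n := m) F p)ᗮ) :
    ∃ e, p ∈ e.source ∧ IsGraphChart F B ν e := by
  have hperp : ∀ x, ⟪B x, ν⟫_ℝ = 0 := fun x =>
    (Submodule.mem_orthogonal _ _).mp hνp _ (hB ▸ ⟨x, rfl⟩)
  have hmd : MDifferentiableAt (𝓡 m) 𝓘(ℝ, E (m + 1)) F p := hF.smooth.mdifferentiable (by simp) p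
  have hd : mfderiv (𝓡 m) 𝓘(ℝ, E m) (fun q => adj B (F q)) p =
      (adj B).comp (mfderiv (𝓡 m) 𝓘(ℝ, E (m + 1)) F p) := by
    have := mfderiv_comp p (adj B).differentiableAt.mdifferentiableAt hmd (g := adj B)
    rw [mfderiv_eq_fderiv, ContinuousLinearMap.fderiv] at this
    exact this
  have hinj : Function.Injective (mfderiv (𝓡 m) 𝓘(ℝ, E m) (fun q => adj B (F q)) p) := by
    rw [hd]
    intro x y hxy
    have hx : ∀ w, ∃ z, B z = mfderiv (𝓡 m) 𝓘(ℝ, E (m + 1)) F p w := fun w => by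
      have : (mfderiv (𝓡 m) 𝓘(ℝ, E (m + 1)) F p : E m →L[ℝ] E (m + 1)) w ∈
          LinearMap.range B.toLinearMap := by
        rw [hB]; exact ⟨w, rfl⟩
      exact this
    obtain ⟨x', hx'⟩ := hx x
    obtain ⟨y', hy'⟩ := hx y
    have h1 : adj B (mfderiv (𝓡 m) 𝓘(ℝ, E (m + 1)) F p x) =
        adj B (mfderiv (𝓡 m) 𝓘(ℝ, E (m + 1)) F p y) := hxy
    apply hF.immersion p
    rw [← hx', ← hy', adj_apply, adj_apply] at h1
    rw [← hx', ← hy', h1]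
  obtain ⟨e, he, hp, heq⟩ := exists_chart_eq
    ((adj B).contDiff.contMDiff.comp hF.smooth) hinj
  exact ⟨e, hp, he, hν, hperp, heq⟩

end GraphChart

/-! ### The unit normal in a graph chart, and the touching principle -/

section Normal

variable {m : ℕ} {M : Type*} [TopologicalSpace M] [ChartedSpace (E m) M]
  {F N : M → E (m + 1)} {B : E m →ₗᵢ[ℝ] E (m + 1)} {ν a : E (m + 1)}
  {e : OpenPartialHomeomorph M (E m)}

theorem IsUnitNormalField.inner_le_one (hN : IsUnitNormalField (n := m) F N) (hν : ‖ν‖ = 1)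
    (q : M) : ⟪N q, ν⟫_ℝ ≤ 1 := by
  have := real_inner_le_norm (N q) ν
  rwa [hN.norm_eq_one, hν, one_mul] at this

/-- The normal component of `a` is, up to the factor `⟪N, ν⟫`, an affine function of `Du`. -/
theorem IsGraphChart.inner_normal_eq (h : IsGraphChart F B ν e)
    (hF : ContMDiff (𝓡 m) 𝓘(ℝ, E (m + 1)) ∞ F) (hN : IsUnitNormalField (n := m) F N)
    (a : E (m + 1)) {q : M} (hq : q ∈ e.source) :
    ⟪N q, a⟫_ℝ = ⟪N q, ν⟫_ℝ * (⟪ν, a⟫_ℝ - dirDeriv (adj B a) (height F ν e) (e q)) := by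
  have h1 := (h.mem_orthogonal_iff hF hq _).mp (hN.normal q)
  conv_lhs => rw [range_adj_add_normal h.norm_normal h.inner_normal a]
  rw [inner_add_right, inner_smul_right, h1, real_inner_comm ν a]
  ring

theorem IsGraphChart.one_eq (h : IsGraphChart F B ν e)
    (hF : ContMDiff (𝓡 m) 𝓘(ℝ, E (m + 1)) ∞ F) (hN : IsUnitNormalField (n := m) F N)
    {q : M} (hq : q ∈ e.source) :
    1 = ⟪N q, ν⟫_ℝ ^ 2 * (1 + gradSq (height F ν e) (e q)) := by
  have h1 := (h.mem_orthogonal_iff hF hq _).mp (hN.normal q)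
  have hdec := range_adj_add_normal h.norm_normal h.inner_normal (N q)
  have hnorm : ⟪N q, N q⟫_ℝ = 1 := by
    rw [real_inner_self_eq_norm_sq, hN.norm_eq_one]; norm_num
  have hcoord : ∀ i : Fin m, (adj B (N q)) i =
      - (dirDeriv (stdVec i) (height F ν e) (e q) * ⟪N q, ν⟫_ℝ) := by
    intro i
    rw [← h1, real_inner_comm, ← inner_adj, EuclideanSpace.inner_single_left]
    simp
  have h2 : ⟪N q, B (adj B (N q))⟫_ℝ = ∑ i, (adj B (N q)) i ^ 2 := by
    rw [real_inner_comm, ← inner_adj, real_inner_self_eq_norm_sq, EuclideanSpace.norm_sq_eq]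
    simp
  rw [hdec, inner_add_right, ← hdec, inner_smul_right, h2] at hnorm
  have h3 : ∑ i, (adj B (N q)) i ^ 2 = ⟪N q, ν⟫_ℝ ^ 2 * gradSq (height F ν e) (e q) := by
    rw [gradSq, Finset.mul_sum]
    refine Finset.sum_congr rfl fun i _ => ?_
    rw [hcoord]; ring
  linarith

theorem IsGraphChart.eventually_inner_pos (hN : IsUnitNormalField (n := m) F N) {p : M}
    (hp : p ∈ e.source) (hν : ν = N p) :
    ∀ᶠ z in 𝓝 (e p), 0 < ⟪N (e.symm z), ν⟫_ℝ := by
  have hc : ContinuousAt (fun z => ⟪N (e.symm z), ν⟫_ℝ) (e p) := by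
    have h1 : ContinuousAt e.symm (e p) := e.continuousAt_symm (e.map_source hp)
    exact (hN.continuous.continuousAt.comp h1).inner continuousAt_const
  refine hc.eventually (lt_mem_nhds ?_)
  dsimp only
  rw [e.left_inv hp, hν, real_inner_self_eq_norm_sq, hN.norm_eq_one]
  norm_num

/-- If `⟪N, a⟫ ≥ 0`, then `⟪ν, a⟫ - D_a u` lies above `⟪N, a⟫` near the centre of the chart: the
two differ by a factor `√(1 + |Du|²) ≥ 1`. -/
theorem IsGraphChart.eventually_inner_le (h : IsGraphChart F B ν e)
    (hF : ContMDiff (𝓡 m) 𝓘(ℝ, E (m + 1)) ∞ F) (hN : IsUnitNormalField (n := m) F N)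
    (ha : ∀ q, 0 ≤ ⟪N q, a⟫_ℝ) {p : M} (hp : p ∈ e.source) (hν : ν = N p) :
    ∀ᶠ z in 𝓝 (e p), ⟪N (e.symm z), a⟫_ℝ ≤
      ⟪ν, a⟫_ℝ - dirDeriv (adj B a) (height F ν e) z := by
  filter_upwards [IsGraphChart.eventually_inner_pos hN hp hν,
    e.open_target.mem_nhds (e.map_source hp)] with z hz hzt
  have h1 := h.inner_normal_eq hF hN a (e.map_target hzt)
  rw [e.right_inv hzt] at h1
  have h2 := ha (e.symm z)
  have h3 := hN.inner_le_one h.norm_normal (e.symm z)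
  rw [h1] at h2 ⊢
  have h4 := nonneg_of_mul_nonneg_right h2 hz
  exact mul_le_of_le_one_left h4 h3

variable [IsManifold (𝓡 m) ∞ M]

/-- Every point is the centre of a graph chart over its own tangent plane. -/
theorem exists_isGraphChart_normal (hF : IsProperSelfShrinker (n := m) F)
    (hN : IsUnitNormalField (n := m) F N) (p : M) :
    ∃ B e, LinearMap.range (B : E m →ₗᵢ[ℝ] E (m + 1)).toLinearMap = tangentImage (n := m) F p ∧
      p ∈ e.source ∧ IsGraphChart F B (N p) e := by
  obtain ⟨B, hB⟩ := exists_linearIsometry_range_eq _ (finrank_tangentImage hF p)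
  obtain ⟨e, hp, he⟩ := exists_isGraphChart hF hB (hN.norm_eq_one p) (hN.normal p)
  exact ⟨B, e, hB, hp, he⟩

/-- The function `⟪N, a⟫`, if nonnegative, is a supersolution of the drift Laplacian in the
viscosity sense: a smooth function of the position that touches it from below at `p` has
nonpositive drift Laplacian there. -/
theorem driftLaplacian_nonpos_of_touching (hF : IsProperSelfShrinker (n := m) F)
    (hN : IsUnitNormalField (n := m) F N) (ha : ∀ q, 0 ≤ ⟪N q, a⟫_ℝ) {h : E (m + 1) → ℝ}
    (hh : ContDiff ℝ ∞ h) {p : M} (hmin : IsLocalMin (fun q => ⟪N q, a⟫_ℝ - h (F q)) p) :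
    ∃ B : E m →ₗᵢ[ℝ] E (m + 1), (∀ x, ⟪B x, N p⟫_ℝ = 0) ∧ driftLaplacian B h (F p) ≤ 0 := by
  obtain ⟨B, e, hB, hp, he⟩ := exists_isGraphChart_normal hF hN p
  refine ⟨B, he.inner_normal, ?_⟩
  have hpt := e.map_source hp
  have h0 := he.dirDeriv_height_eq_zero hF.smooth hp hB
  have hFp : (F ∘ e.symm) (e p) = F p := by simp [e.left_inv hp]
  rw [← hFp]
  refine driftLaplacian_nonpos_of_isLocalMin e.open_target (he.height_contDiffOn hF.smooth)
    he.graph hpt h0 (fun z hz => he.graphEquation hF hz) hh ⟪N p, a⟫_ℝ (adj B a) ?_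
  have htend : Tendsto e.symm (𝓝 (e p)) (𝓝 p) := by
    have := e.continuousAt_symm hpt
    rwa [ContinuousAt, e.left_inv hp] at this
  filter_upwards [htend.eventually hmin, he.eventually_inner_le hF.smooth hN ha hp rfl]
    with z hz1 hz2
  rw [h0, hFp]
  simp only [Function.comp_apply] at hz1 ⊢
  linarith

end Normal

/-! ### The minimum principle at infinity -/

section Minimum

variable {m : ℕ} {M : Type*} [TopologicalSpace M] [ChartedSpace (E m) M]
  [IsManifold (𝓡 m) ∞ M] {F N : M → E (m + 1)} {a : E (m + 1)}

theorem driftLaplacian_radial (B : E m →ₗᵢ[ℝ] E (m + 1)) {ψ ψ' ψ'' : ℝ → ℝ}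
    (h1 : ∀ t, HasDerivAt ψ (ψ' t) t) (h2 : ∀ t, HasDerivAt ψ' (ψ'' t) t) (q x : E (m + 1)) :
    driftLaplacian B (fun y => ψ (‖y - q‖ ^ 2)) x =
      4 * ψ'' (‖x - q‖ ^ 2) * ‖adj B (x - q)‖ ^ 2 +
        ψ' (‖x - q‖ ^ 2) * (2 * m - ⟪x - q, x⟫_ℝ) := by
  have hr : ∀ y, HasFDerivAt (fun y : E (m + 1) => ‖y - q‖ ^ 2) (2 • innerSL ℝ (y - q)) y :=
    fun y => by simpa using ((hasFDerivAt_id y).sub_const q).norm_sq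
  have hcomp : ∀ {g g' : ℝ → ℝ}, (∀ t, HasDerivAt g (g' t) t) → ∀ y,
      HasFDerivAt (fun y : E (m + 1) => g (‖y - q‖ ^ 2))
        (g' (‖y - q‖ ^ 2) • (2 • innerSL ℝ (y - q))) y :=
    fun hg y => (hg _).comp_hasFDerivAt y (hr y)
  have e1 : ∀ b, dirDeriv b (fun y : E (m + 1) => ψ (‖y - q‖ ^ 2)) =
      fun y => ψ' (‖y - q‖ ^ 2) * (2 * ⟪y - q, b⟫_ℝ) := by
    intro b; funext y
    rw [dirDeriv, (hcomp h1 y).fderiv]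
    simp [inner_sub_left]
  have e2 : ∀ b, dirDeriv b (fun y : E (m + 1) => ψ' (‖y - q‖ ^ 2) * (2 * ⟪y - q, b⟫_ℝ)) x =
      4 * ψ'' (‖x - q‖ ^ 2) * ⟪x - q, b⟫_ℝ ^ 2 + 2 * ψ' (‖x - q‖ ^ 2) * ‖b‖ ^ 2 := by
    intro b
    have hi : HasFDerivAt (fun y : E (m + 1) => 2 * ⟪y - q, b⟫_ℝ) (2 • innerSL ℝ b) x := by
      have h := ((innerSL ℝ b).hasFDerivAt.comp x ((hasFDerivAt_id x).sub_const q)).const_mul 2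
      refine (h.congr_of_eventuallyEq ?_).congr_fderiv ?_
      · exact Eventually.of_forall fun y => by simp [real_inner_comm]
      · ext; simp
    rw [dirDeriv, ((hcomp h2 x).fun_mul hi).fderiv]
    simp [inner_sub_left]
    ring
  have e3 : ∑ i, ⟪x - q, B (stdVec i)⟫_ℝ ^ 2 = ‖adj B (x - q)‖ ^ 2 := by
    rw [EuclideanSpace.norm_sq_eq]
    refine Finset.sum_congr rfl fun i _ => ?_
    rw [real_inner_comm, ← inner_adj, EuclideanSpace.inner_single_left]
    simp
  simp only [driftLaplacian, e1, e2, Finset.sum_add_distrib, ← Finset.mul_sum, e3, B.norm_map]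
  simp
  ring

/-- A nonnegative `⟪N, a⟫` attains its infimum. The perturbation `⟪N, a⟫ + ε |F|²` is coercive, and
it attains its minimum only at points with `|F|² ≤ 2m`, since `|F|²` has negative drift
Laplacian elsewhere. -/
theorem exists_forall_inner_le [Nonempty M] (hF : IsProperSelfShrinker (n := m) F)
    (hN : IsUnitNormalField (n := m) F N) (ha : ∀ q, 0 ≤ ⟪N q, a⟫_ℝ) :
    ∃ p, ∀ q, ⟪N p, a⟫_ℝ ≤ ⟪N q, a⟫_ℝ := by
  have hvc : Continuous fun q => ⟪N q, a⟫_ℝ := hN.continuous.inner continuous_const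
  have hFc : Continuous F := hF.smooth.continuous
  set K : Set M := F ⁻¹' Metric.closedBall 0 √(2 * m) with hK
  have hKc : IsCompact K := hF.proper.isCompact_preimage (isCompact_closedBall _ _)
  have hmin : ∀ ε : ℝ, 0 < ε → ∃ p ∈ K, ∀ q, ⟪N p, a⟫_ℝ ≤ ⟪N q, a⟫_ℝ + ε * ‖F q‖ ^ 2 := by
    intro ε hε
    obtain ⟨q₀⟩ := ‹Nonempty M›
    have hcoer : ∀ᶠ q in cocompact M, ⟪N q₀, a⟫_ℝ + ε * ‖F q₀‖ ^ 2 ≤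
        ⟪N q, a⟫_ℝ + ε * ‖F q‖ ^ 2 := by
      set R := ⟪N q₀, a⟫_ℝ + ε * ‖F q₀‖ ^ 2 with hR
      have hR0 : 0 ≤ R := add_nonneg (ha q₀) (by positivity)
      have hc : IsCompact (F ⁻¹' Metric.closedBall 0 √(R / ε)) :=
        hF.proper.isCompact_preimage (isCompact_closedBall _ _)
      filter_upwards [hc.compl_mem_cocompact] with q hq
      have hq' : √(R / ε) < ‖F q‖ := by simpa using hq
      have hsq : R / ε < ‖F q‖ ^ 2 := (Real.sqrt_lt' ((Real.sqrt_nonneg _).trans_lt hq')).mp hq'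
      rw [div_lt_iff₀ hε] at hsq
      nlinarith [ha q]
    have hcont : Continuous fun q => ⟪N q, a⟫_ℝ + ε * ‖F q‖ ^ 2 := by fun_prop
    obtain ⟨p, hp⟩ := hcont.exists_forall_le' q₀ hcoer
    have hloc : IsLocalMin (fun q => ⟪N q, a⟫_ℝ - (fun y => -ε * ‖y - 0‖ ^ 2) (F q)) p := by
      refine Eventually.of_forall fun q => ?_
      have := hp q
      simp only [sub_zero]
      linarith
    obtain ⟨B, -, hB⟩ := driftLaplacian_nonpos_of_touching hF hN ha
      (contDiff_const.mul ((contDiff_id.sub contDiff_const).norm_sq ℝ)) hloc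
    have hψ : ∀ t, HasDerivAt (fun t : ℝ => -ε * t) (-ε) t := fun t => by
      simpa using (hasDerivAt_id t).const_mul (-ε)
    have hB' := driftLaplacian_radial B hψ (fun t => hasDerivAt_const t (-ε)) 0 (F p)
    rw [sub_zero, real_inner_self_eq_norm_sq] at hB'
    have hB2 : ε * (‖F p‖ ^ 2 - 2 * m) ≤ 0 := by
      have := hB'.symm.trans_le hB
      linarith
    have hle : ‖F p‖ ^ 2 ≤ 2 * m := by
      have := nonpos_of_mul_nonpos_right hB2 hε
      linarith
    refine ⟨p, ?_, fun q => ?_⟩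
    · simpa [hK] using Real.le_sqrt_of_sq_le hle
    · have := hp q
      have h2 : 0 ≤ ε * ‖F p‖ ^ 2 := by positivity
      linarith
  obtain ⟨p₁, hp₁, -⟩ := hmin 1 one_pos
  obtain ⟨p, hpK, hp⟩ := hKc.exists_isMinOn ⟨p₁, hp₁⟩ hvc.continuousOn
  refine ⟨p, fun q => ?_⟩
  refine le_of_forall_pos_le_add fun δ hδ => ?_
  obtain ⟨p', hp'K, hp'⟩ := hmin (δ / (‖F q‖ ^ 2 + 1)) (by positivity)
  have h1 : ⟪N p, a⟫_ℝ ≤ ⟪N p', a⟫_ℝ := hp hp'K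
  have h2 := hp' q
  have h3 : δ / (‖F q‖ ^ 2 + 1) * ‖F q‖ ^ 2 ≤ δ := by
    rw [div_mul_eq_mul_div, div_le_iff₀ (by positivity)]
    nlinarith
  linarith

end Minimum

/-! ### The strong minimum principle -/

section Strong

variable {m : ℕ} {M : Type*} [TopologicalSpace M] [ChartedSpace (E m) M]
  [IsManifold (𝓡 m) ∞ M] {F N : M → E (m + 1)} {a : E (m + 1)}

/-- Locally, a chord of the hypersurface is never normal to it. In particular `F` is locally
injective. -/
theorem exists_nhds_chord_not_normal (hF : IsProperSelfShrinker (n := m) F)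
    (hN : IsUnitNormalField (n := m) F N) (p : M) :
    ∃ O ∈ 𝓝 p, ∀ x ∈ O, ∀ y ∈ O, ∀ c : ℝ, F x - F y = c • N y → x = y := by
  obtain ⟨B, e, hB, hp, he⟩ := exists_isGraphChart_normal hF hN p
  have husm := he.height_contDiffOn hF.smooth
  set u := height F (N p) e with hu
  have hpt := e.map_source hp
  have h0 := he.dirDeriv_height_eq_zero hF.smooth hp hB
  -- a ball on which the slope is at most `1 / 2`
  have hcont : ContinuousAt (fderiv ℝ u) (e p) :=
    ((husm.fderiv_of_isOpen (m := ∞) e.open_target (by simp)).continuousOn).continuousAt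
      (e.open_target.mem_nhds hpt)
  have hsmall : ∀ᶠ z in 𝓝 (e p), ‖fderiv ℝ u z‖ < 1 / 2 := by
    refine hcont.norm.eventually (gt_mem_nhds ?_)
    have : fderiv ℝ u (e p) = 0 := by ext x; exact h0 x
    dsimp only
    rw [this, norm_zero]; norm_num
  obtain ⟨r, hr, hball⟩ := Metric.eventually_nhds_iff_ball.mp
    (hsmall.and (e.open_target.mem_nhds hpt))
  refine ⟨e.source ∩ e ⁻¹' Metric.ball (e p) r,
    (e.isOpen_inter_preimage Metric.isOpen_ball).mem_nhds ⟨hp, Metric.mem_ball_self hr⟩, ?_⟩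
  rintro x ⟨hxs, hx⟩ y ⟨hys, hy⟩ c hc
  have hgr : ∀ q ∈ e.source, F q = B (e q) + u (e q) • N p := fun q hq => by
    have := he.graph _ (e.map_source hq)
    simpa [e.left_inv hq] using this
  have hlip : |u (e x) - u (e y)| ≤ 1 / 2 * ‖e x - e y‖ :=
    (convex_ball (e p) r).norm_image_sub_le_of_norm_fderiv_le
      (fun z hz => differentiableAt_of_contDiffOn e.open_target husm (hball z hz).2)
      (fun z hz => (hball z hz).1.le) hy hx
  have hν : ⟪N p, N p⟫_ℝ = 1 := by
    rw [real_inner_self_eq_norm_sq, he.norm_normal]; norm_num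
  set w := e x - e y with hw
  have hdiff : F x - F y = B w + (u (e x) - u (e y)) • N p := by
    rw [hgr x hxs, hgr y hys, hw, map_sub, sub_smul]; abel
  -- the normal and tangential components of the chord
  have hn : u (e x) - u (e y) = c * ⟪N y, N p⟫_ℝ := by
    have := congrArg (fun v => ⟪v, N p⟫_ℝ) (hdiff.symm.trans hc)
    simpa [inner_add_left, inner_smul_left, he.inner_normal, he.norm_normal] using this
  have ht : ‖w‖ ^ 2 = -(fderiv ℝ u (e y) w * (u (e x) - u (e y))) := by
    have h1 := congrArg (fun v => ⟪v, B w⟫_ℝ) (hdiff.symm.trans hc)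
    have h2 := (he.mem_orthogonal_iff hF.smooth hys _).mp (hN.normal y) w
    have h3 : ⟪N p, B w⟫_ℝ = 0 := by rw [real_inner_comm]; exact he.inner_normal w
    simp only [inner_add_left, inner_smul_left, B.inner_map_map, h2, h3,
      real_inner_self_eq_norm_sq] at h1
    simp only [dirDeriv, conj_trivial] at h1
    rw [hn]
    linarith
  have hb : ‖fderiv ℝ u (e y) w‖ ≤ 1 / 2 * ‖w‖ :=
    ((fderiv ℝ u (e y)).le_opNorm w).trans
      (mul_le_mul_of_nonneg_right (hball _ hy).1.le (norm_nonneg _))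
  have hle : ‖w‖ ^ 2 ≤ (1 / 2 * ‖w‖) * (1 / 2 * ‖w‖) := by
    calc ‖w‖ ^ 2 ≤ |fderiv ℝ u (e y) w * (u (e x) - u (e y))| := by
          rw [ht]; exact neg_le_abs _
      _ = ‖fderiv ℝ u (e y) w‖ * |u (e x) - u (e y)| := by rw [abs_mul]; rfl
      _ ≤ _ := mul_le_mul hb hlip (abs_nonneg _) (by positivity)
  have hw0 : w = 0 := by
    have : ‖w‖ = 0 := by nlinarith [norm_nonneg w]
    exact norm_eq_zero.mp this
  exact e.injOn hxs hys (sub_eq_zero.mp hw0)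

theorem norm_adj_sq {B : E m →ₗᵢ[ℝ] E (m + 1)} {ν : E (m + 1)} (hν : ‖ν‖ = 1)
    (hB : ∀ x, ⟪B x, ν⟫_ℝ = 0) (w : E (m + 1)) :
    ‖adj B w‖ ^ 2 = ‖w‖ ^ 2 - ⟪w, ν⟫_ℝ ^ 2 := by
  have h := range_adj_add_normal hν hB w
  have h1 : ⟪w, w⟫_ℝ = ⟪w, B (adj B w)⟫_ℝ + ⟪w, ν⟫_ℝ * ⟪w, ν⟫_ℝ := by
    conv_lhs => rw [h, inner_add_left, inner_smul_left, ← h, real_inner_comm, real_inner_comm w ν]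
    simp
  rw [real_inner_comm (B (adj B w)) w, ← inner_adj, real_inner_self_eq_norm_sq,
    real_inner_self_eq_norm_sq] at h1
  linarith

theorem sub_inner_sq_pos {w ν : E (m + 1)} (hν : ‖ν‖ = 1) (hw : ∀ c : ℝ, w ≠ c • ν) :
    0 < ‖w‖ ^ 2 - ⟪w, ν⟫_ℝ ^ 2 := by
  have h : 0 < ‖w - ⟪w, ν⟫_ℝ • ν‖ ^ 2 := by
    have := norm_pos_iff.mpr (sub_ne_zero.mpr (hw ⟪w, ν⟫_ℝ))
    positivity
  rw [norm_sub_sq_real, inner_smul_right, norm_smul, hν, mul_one, Real.norm_eq_abs, sq_abs] at h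
  nlinarith

/-- The closed ball with diameter `[0, w]` touches the complement of the open ball of radius `‖w‖`
around `w` only at the origin. -/
theorem norm_sub_lt_of_mem_ball {V : Type*} [NormedAddCommGroup V] [InnerProductSpace ℝ V]
    {x w : V} (hx : ‖x - (1 / 2 : ℝ) • w‖ ≤ ‖w‖ / 2) (hx0 : x ≠ 0) : ‖x - w‖ < ‖w‖ := by
  have h1 : ‖x - (1 / 2 : ℝ) • w‖ ^ 2 ≤ (‖w‖ / 2) ^ 2 :=
    pow_le_pow_left₀ (norm_nonneg _) hx 2
  rw [norm_sub_sq_real, inner_smul_right, norm_smul] at h1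
  norm_num at h1
  have h2 := norm_pos_iff.mpr hx0
  have h3 : ‖x - w‖ ^ 2 < ‖w‖ ^ 2 := by
    rw [norm_sub_sq_real]
    nlinarith [sq_pos_of_pos h2]
  exact lt_of_pow_lt_pow_left₀ 2 (norm_nonneg _) h3

/-- Hopf's argument: the set where `⟪N, a⟫` attains its minimum is open. Otherwise a ball in
`ℝᵐ⁺¹` touches it from outside, and the usual exponential barrier `ε exp (-α |x - c|²)` of that
ball touches `⟪N, a⟫` from below at a point where its drift Laplacian is positive. -/
theorem mem_nhds_setOf_inner_eq_min [T2Space M] (hF : IsProperSelfShrinker (n := m) F)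
    (hN : IsUnitNormalField (n := m) F N) (ha : ∀ q, 0 ≤ ⟪N q, a⟫_ℝ) {μ : ℝ}
    (hμ : ∀ q, μ ≤ ⟪N q, a⟫_ℝ) {p : M} (hp : ⟪N p, a⟫_ℝ = μ) :
    {q | ⟪N q, a⟫_ℝ = μ} ∈ 𝓝 p := by
  by_contra hnot
  have : LocallyCompactSpace M := ChartedSpace.locallyCompactSpace (E m) M
  have hvc : Continuous fun q => ⟪N q, a⟫_ℝ := hN.continuous.inner continuous_const
  have hFc : Continuous F := hF.smooth.continuous
  set Z : Set M := {q | ⟪N q, a⟫_ℝ = μ} with hZ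
  have hZc : IsClosed Z := isClosed_eq hvc continuous_const
  obtain ⟨O, hO, hchord⟩ := exists_nhds_chord_not_normal hF hN p
  have hinj : ∀ x ∈ O, ∀ y ∈ O, F x = F y → x = y := fun x hx y hy h =>
    hchord x hx y hy 0 (by rw [h, sub_self, zero_smul])
  obtain ⟨K, hKp, hKO, hKc⟩ := local_compact_nhds hO
  have hpK : p ∈ interior K := mem_interior_iff_mem_nhds.mpr hKp
  -- points of `K` whose image is close to `F p` are interior to `K`
  obtain ⟨δ, hδ, hδK⟩ : ∃ δ > 0, ∀ x ∈ K, ‖F x - F p‖ < δ → x ∈ interior K := by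
    have hc : IsClosed (F '' (K \ interior K)) :=
      ((hKc.diff isOpen_interior).image hFc).isClosed
    have hpn : F p ∈ (F '' (K \ interior K))ᶜ := by
      rintro ⟨x, hx, hxp⟩
      have := hinj x (hKO hx.1) p (hKO (interior_subset hpK)) hxp
      exact hx.2 (this ▸ hpK)
    obtain ⟨δ, hδ, hsub⟩ := Metric.isOpen_iff.mp hc.isOpen_compl _ hpn
    refine ⟨δ, hδ, fun x hx hlt => by_contra fun hxi => ?_⟩
    exact hsub (by rwa [Metric.mem_ball, dist_eq_norm]) ⟨x, ⟨hx, hxi⟩, rfl⟩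
  -- a point `q` near `p`, off `Z`
  obtain ⟨q, ⟨hqK, hqδ⟩, hqZ⟩ : ∃ q, (q ∈ interior K ∧ ‖F q - F p‖ < δ / 2) ∧ q ∉ Z := by
    by_contra! hall
    refine hnot (mem_of_superset (inter_mem (isOpen_interior.mem_nhds hpK) ?_)
      fun q hq => hall q hq)
    have : Continuous fun q => ‖F q - F p‖ := (hFc.sub continuous_const).norm
    exact (isOpen_lt this continuous_const).mem_nhds (by simpa using half_pos hδ)
  -- the point `z` of `Z ∩ K` nearest to `q`
  obtain ⟨z, ⟨hzK, hzZ⟩, hzmin⟩ := (hKc.inter_right hZc).exists_isMinOn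
    ⟨p, interior_subset hpK, hp⟩ (f := fun x => ‖F x - F q‖)
    ((hFc.sub continuous_const).norm).continuousOn
  have hzmin' : ∀ x ∈ K, x ∈ Z → ‖F z - F q‖ ≤ ‖F x - F q‖ := fun x hx hxZ => hzmin ⟨hx, hxZ⟩
  have hzi : z ∈ interior K := by
    refine hδK z hzK ?_
    have h1 := hzmin' p (interior_subset hpK) hp
    have h2 : ‖F z - F p‖ ≤ ‖F z - F q‖ + ‖F q - F p‖ := by
      simpa using norm_sub_le_norm_sub_add_norm_sub (F z) (F q) (F p)
    rw [norm_sub_rev (F p)] at h1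
    linarith
  have hqz : q ≠ z := fun h => hqZ (h ▸ hzZ)
  -- the smaller ball, with diameter `[F z, F q]`, touches `Z` only at `z`
  set w := F q - F z with hw
  set c := F z + (1 / 2 : ℝ) • w with hc
  have hzc : F z - c = (-(1 / 2) : ℝ) • w := by rw [hc, neg_smul]; abel
  set A : M → ℝ := fun x => ‖F x - c‖ ^ 2 - ⟪F x - c, N x⟫_ℝ ^ 2 with hA
  have hAc : Continuous A := by
    have h1 : Continuous fun x => F x - c := hFc.sub continuous_const
    exact (h1.norm.pow 2).sub ((h1.inner hN.continuous).pow 2)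
  have hAz : 0 < A z := by
    refine sub_inner_sq_pos (hN.norm_eq_one z) fun b hb => hqz ?_
    refine hchord q (hKO (interior_subset hqK)) z (hKO hzK) (-2 * b) ?_
    rw [hzc] at hb
    rw [mul_smul, ← hb, smul_smul, ← hw]
    norm_num
  obtain ⟨α, hα, hαz⟩ : ∃ α : ℝ, 0 < α ∧ 2 * m < 4 * α * A z + ⟪F z - c, F z⟫_ℝ := by
    refine ⟨(|2 * m - ⟪F z - c, F z⟫_ℝ| + 1) / (4 * A z), by positivity, ?_⟩
    have h1 : 4 * ((|2 * m - ⟪F z - c, F z⟫_ℝ| + 1) / (4 * A z)) * A z =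
        |2 * m - ⟪F z - c, F z⟫_ℝ| + 1 := by
      field_simp
    rw [h1]
    linarith [le_abs_self (2 * m - ⟪F z - c, F z⟫_ℝ)]
  have hopen : IsOpen {x | 2 * (m : ℝ) < 4 * α * A x + ⟪F x - c, F x⟫_ℝ} :=
    isOpen_lt continuous_const ((continuous_const.mul hAc).add
      ((hFc.sub continuous_const).inner hFc))
  obtain ⟨C, hCz, hCsub, hCc⟩ := local_compact_nhds
    (inter_mem (isOpen_interior.mem_nhds hzi) (hopen.mem_nhds hαz))
  have hzC : z ∈ interior C := mem_interior_iff_mem_nhds.mpr hCz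
  set g : M → ℝ := fun x => Real.exp (-α * ‖F x - c‖ ^ 2) with hg
  have hgc : Continuous g := by
    have h1 : Continuous fun x => F x - c := hFc.sub continuous_const
    exact Real.continuous_exp.comp (continuous_const.mul (h1.norm.pow 2))
  have hg1 : ∀ x, g x ≤ 1 := fun x => by
    refine Real.exp_le_one_iff.mpr ?_
    have : 0 ≤ α * ‖F x - c‖ ^ 2 := by positivity
    linarith
  have hg0 : ∀ x, 0 < g x := fun x => Real.exp_pos _
  -- inside the ball, away from `z`, the function `⟪N, a⟫` exceeds its minimum
  have hstrict : ∀ x ∈ K, x ≠ z → g z ≤ g x → μ < ⟪N x, a⟫_ℝ := by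
    intro x hx hxz hle
    refine lt_of_le_of_ne (hμ x) fun heq => ?_
    have h1 : ‖F x - c‖ ^ 2 ≤ ‖F z - c‖ ^ 2 := by
      have := Real.exp_le_exp.mp hle
      nlinarith
    have h2 : ‖F x - c‖ ≤ ‖F z - c‖ := le_of_sq_le_sq h1 (norm_nonneg _)
    rw [hzc, norm_smul] at h2
    have h3 : ‖(F x - F z) - (1 / 2 : ℝ) • w‖ ≤ ‖w‖ / 2 := by
      have : (F x - F z) - (1 / 2 : ℝ) • w = F x - c := by rw [hc]; abel
      rw [this]
      norm_num at h2
      linarith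
    have h4 := norm_sub_lt_of_mem_ball h3
      (sub_ne_zero.mpr fun h => hxz (hinj x (hKO hx) z (hKO hzK) h))
    have h5 : (F x - F z) - w = F x - F q := by rw [hw]; abel
    rw [h5, hw, norm_sub_rev (F q)] at h4
    exact absurd (hzmin' x hx heq.symm) (not_le.mpr h4)
  have hCK : C ⊆ K := fun x hx => interior_subset (hCsub hx).1
  obtain ⟨ε, hε, hbd⟩ : ∃ ε > 0, ∀ x ∈ C \ interior C, g z ≤ g x → μ + ε ≤ ⟪N x, a⟫_ℝ := by
    set D := (C \ interior C) ∩ {x | g z ≤ g x} with hD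
    have hDc : IsCompact D :=
      (hCc.diff isOpen_interior).inter_right (isClosed_le continuous_const hgc)
    rcases D.eq_empty_or_nonempty with hemp | hne
    · exact ⟨1, one_pos, fun x hx hle => absurd (show x ∈ D from ⟨hx, hle⟩) (by simp [hemp])⟩
    · obtain ⟨x₀, hx₀, hmin⟩ := hDc.exists_isMinOn hne hvc.continuousOn
      refine ⟨⟪N x₀, a⟫_ℝ - μ, sub_pos.mpr (hstrict x₀ (hCK hx₀.1.1) ?_ hx₀.2),
        fun x hx hle => ?_⟩
      · rintro rfl; exact hx₀.1.2 hzC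
      · have : ⟪N x₀, a⟫_ℝ ≤ ⟪N x, a⟫_ℝ := hmin ⟨hx, hle⟩
        linarith
  -- hence `⟪N, a⟫ - ε g` has an interior minimum on `C`
  obtain ⟨x, hxC, hxmin⟩ := hCc.exists_isMinOn ⟨z, interior_subset hzC⟩
    (f := fun x => ⟪N x, a⟫_ℝ - ε * g x) (hvc.sub (continuous_const.mul hgc)).continuousOn
  have hxi : x ∈ interior C := by
    by_contra hxn
    have h1 : ⟪N x, a⟫_ℝ - ε * g x ≤ ⟪N z, a⟫_ℝ - ε * g z := hxmin (interior_subset hzC)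
    have hzμ : ⟪N z, a⟫_ℝ = μ := hzZ
    rw [hzμ] at h1
    rcases le_or_gt (g z) (g x) with hle | hlt
    · have h2 := hbd x ⟨hxC, hxn⟩ hle
      have h3 : ε * g x ≤ ε * 1 := mul_le_mul_of_nonneg_left (hg1 x) hε.le
      have h4 : 0 < ε * g z := mul_pos hε (hg0 z)
      linarith
    · have h3 : ε * g x < ε * g z := mul_lt_mul_of_pos_left hlt hε
      linarith [hμ x]
  have hloc : IsLocalMin (fun y => ⟪N y, a⟫_ℝ -
      (fun Y => ε * Real.exp (-α * ‖Y - c‖ ^ 2)) (F y)) x := by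
    filter_upwards [isOpen_interior.mem_nhds hxi] with y hy
    exact hxmin (interior_subset hy)
  obtain ⟨B, hBν, hB⟩ := driftLaplacian_nonpos_of_touching hF hN ha
    (contDiff_const.mul (Real.contDiff_exp.comp
      (contDiff_const.mul ((contDiff_id.sub contDiff_const).norm_sq ℝ)))) hloc
  have d0 : ∀ t, HasDerivAt (fun t : ℝ => Real.exp (-α * t)) (-α * Real.exp (-α * t)) t := by
    intro t
    have := ((hasDerivAt_id t).const_mul (-α)).exp
    simpa [mul_comm] using this
  have d1 : ∀ t, HasDerivAt (fun t : ℝ => ε * Real.exp (-α * t))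
      (ε * (-α * Real.exp (-α * t))) t := fun t => (d0 t).const_mul ε
  have d2 : ∀ t, HasDerivAt (fun t : ℝ => ε * (-α * Real.exp (-α * t)))
      (ε * (-α * (-α * Real.exp (-α * t)))) t := fun t => ((d0 t).const_mul (-α)).const_mul ε
  have hval := (driftLaplacian_radial B d1 d2 c (F x)).symm.trans_le hB
  rw [norm_adj_sq (hN.norm_eq_one x) hBν] at hval
  have hpos : 0 < ε * α * Real.exp (-α * ‖F x - c‖ ^ 2) *
      (4 * α * A x + ⟪F x - c, F x⟫_ℝ - 2 * m) := by
    have : 2 * (m : ℝ) < 4 * α * A x + ⟪F x - c, F x⟫_ℝ := (hCsub hxC).2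
    have h' : 0 < 4 * α * A x + ⟪F x - c, F x⟫_ℝ - 2 * m := by linarith
    positivity
  refine absurd hpos (not_lt.mpr (le_trans (le_of_eq ?_) hval))
  simp only [hA]
  ring

theorem inner_normal_const [T2Space M] [ConnectedSpace M] (hF : IsProperSelfShrinker (n := m) F)
    (hN : IsUnitNormalField (n := m) F N) (ha : ∀ q, 0 ≤ ⟪N q, a⟫_ℝ) :
    ∃ μ, 0 ≤ μ ∧ ∀ q, ⟪N q, a⟫_ℝ = μ := by
  obtain ⟨p, hp⟩ := exists_forall_inner_le hF hN ha
  refine ⟨⟪N p, a⟫_ℝ, ha p, fun q => ?_⟩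
  have hclopen : IsClopen {q | ⟪N q, a⟫_ℝ = ⟪N p, a⟫_ℝ} := by
    refine ⟨isClosed_eq (hN.continuous.inner continuous_const) continuous_const, ?_⟩
    exact isOpen_iff_mem_nhds.mpr fun q hq => mem_nhds_setOf_inner_eq_min hF hN ha hp hq
  exact (hclopen.eq_univ ⟨p, rfl⟩).ge (mem_univ q)

end Strong

/-! ### The flat case: a constant positive normal component -/

section Flat

/-- A function on a connected manifold is constant if at each point its derivative vanishes in some
chart, which may depend on the point. -/
theorem eq_of_hasFDerivAt_chart_zero {m : ℕ} {M : Type*} [TopologicalSpace M]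
    [ChartedSpace (E m) M] [IsManifold (𝓡 m) ∞ M] [PreconnectedSpace M] {s : M → ℝ}
    (hs : ∀ p, ∃ e ∈ IsManifold.maximalAtlas (𝓡 m) ∞ M, p ∈ e.source ∧
      HasFDerivAt (s ∘ e.symm) (0 : E m →L[ℝ] ℝ) (e p)) (p q : M) : s p = s q := by
  have hm : ∀ p, HasMFDerivAt (𝓡 m) 𝓘(ℝ, ℝ) s p (0 : E m →L[ℝ] ℝ) := by
    intro p
    obtain ⟨e, he, hp, hd⟩ := hs p
    have h1 : MDifferentiableAt (𝓡 m) (𝓡 m) e p :=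
      (contMDiffAt_of_mem_maximalAtlas he hp).mdifferentiableAt (by simp)
    have h2 := hd.hasMFDerivAt.comp p h1.hasMFDerivAt
    refine (h2.congr_of_eventuallyEq ?_).congr_mfderiv ?_
    · filter_upwards [e.open_source.mem_nhds hp] with x hx
      simp [e.left_inv hx]
    · ext x; rfl
  have hloc : IsLocallyConstant s := by
    rw [IsLocallyConstant.iff_eventually_eq]
    intro p
    set e := chartAt (E m) p with he
    have hat : e ∈ IsManifold.maximalAtlas (𝓡 m) ∞ M := IsManifold.chart_mem_maximalAtlas p
    have hp : p ∈ e.source := mem_chart_source _ p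
    have hd : ∀ z ∈ e.target, HasFDerivAt (s ∘ e.symm) (0 : E m →L[ℝ] ℝ) z := by
      intro z hz
      have h1 : MDifferentiableAt (𝓡 m) (𝓡 m) e.symm z :=
        (contMDiffAt_symm_of_mem_maximalAtlas hat hz).mdifferentiableAt (by simp)
      have h2 := ((hm (e.symm z)).comp z h1.hasMFDerivAt).hasFDerivAt
      refine h2.congr_fderiv ?_
      ext x; rfl
    obtain ⟨r, hr, hball⟩ := Metric.isOpen_iff.mp e.open_target _ (e.map_source hp)
    filter_upwards [(e.isOpen_inter_preimage Metric.isOpen_ball).mem_nhds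
      ⟨hp, Metric.mem_ball_self hr⟩] with x hx
    have := (convex_ball (e p) r).is_const_of_fderivWithin_eq_zero (𝕜 := ℝ) (f := s ∘ e.symm)
      (fun z hz => (hd z (hball hz)).differentiableAt.differentiableWithinAt)
      (fun z hz => by
        rw [fderivWithin_of_isOpen Metric.isOpen_ball hz]; exact (hd z (hball hz)).fderiv)
      hx.2 (Metric.mem_ball_self hr)
    simpa [e.left_inv hx.1, e.left_inv hp] using this
  exact hloc.apply_eq_of_preconnectedSpace p q

/-- A proper local homeomorphism onto a simply connected space is bijective. -/
theorem bijective_of_isLocalHomeomorph_of_isProperMap {X Y : Type*} [TopologicalSpace X]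
    [TopologicalSpace Y] [T2Space X] [T1Space Y] [ConnectedSpace X] [SimplyConnectedSpace Y]
    [LocallyPathConnectedSpace Y] {G : X → Y} (hG : IsLocalHomeomorph G) (hp : IsProperMap G) :
    Function.Bijective G := by
  have hcov : IsCoveringMap G := by
    rw [isCoveringMap_iff_isCoveringMapOn_univ]
    refine hp.isClosedMap.isCoveringMapOn_of_isLocalHomeomorphOn (fun y _ => ?_)
      fun x _ => ?_
    · refine (hp.isCompact_preimage isCompact_singleton).finite
        (IsDiscrete.of_openPartialHomeomorph G subset_rfl fun x _ => ?_)
      obtain ⟨φ, hφ, h⟩ := hG x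
      exact ⟨φ, hφ, h.symm⟩
    · exact hG x
  obtain ⟨x₀⟩ := (inferInstance : Nonempty X)
  obtain ⟨S, ⟨hS0, hS⟩, -⟩ :=
    hcov.existsUnique_continuousMap_lifts (ContinuousMap.id Y) (G x₀) x₀ rfl
  have hS' : ∀ y, G (S y) = y := fun y => congrFun hS y
  have hinv : (fun x => S (G x)) = id :=
    hcov.eq_of_comp_eq (S.continuous.comp hp.continuous) continuous_id
      (by funext x; exact hS' (G x)) x₀ hS0
  exact ⟨Function.LeftInverse.injective (congrFun hinv), fun y => ⟨S y, hS' y⟩⟩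

variable {m : ℕ} {M : Type*} [TopologicalSpace M] [ChartedSpace (E m) M]
  [IsManifold (𝓡 m) ∞ M] {F N : M → E (m + 1)} {a : E (m + 1)} {μ : ℝ}

/-- If `⟪N, a⟫` is a positive constant, then the second fundamental form vanishes: the graph over
the tangent plane at `p` agrees with it to second order. -/
theorem exists_isGraphChart_flat (hF : IsProperSelfShrinker (n := m) F)
    (hN : IsUnitNormalField (n := m) F N) (hμ : 0 < μ) (ha : ∀ q, ⟪N q, a⟫_ℝ = μ) (p : M) :
    ∃ B e, p ∈ e.source ∧ IsGraphChart F B (N p) e ∧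
      (∀ x, dirDeriv x (height F (N p) e) (e p) = 0) ∧
      (∀ x y, dirDeriv x (dirDeriv y (height F (N p) e)) (e p) = 0) ∧ ⟪F p, N p⟫_ℝ = 0 := by
  obtain ⟨B, e, hB, hp, he⟩ := exists_isGraphChart_normal hF hN p
  have hpt := e.map_source hp
  have h0 := he.dirDeriv_height_eq_zero hF.smooth hp hB
  have husm := he.height_contDiffOn hF.smooth
  have hess : ∀ x y, dirDeriv x (dirDeriv y (height F (N p) e)) (e p) = 0 := by
    refine hessian_eq_zero_of_sq_eq e.open_target husm hpt h0
      (fun z hz => he.graphEquation hF hz) hμ.ne' (adj B a) ?_ ?_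
    · filter_upwards [he.eventually_inner_le hF.smooth hN (fun q => (ha q).symm ▸ hμ.le) hp rfl]
        with z hz
      rw [h0, sub_zero]
      rwa [ha, ha] at hz
    · filter_upwards [e.open_target.mem_nhds hpt] with z hz
      have h1 := he.inner_normal_eq hF.smooth hN a (e.map_target hz)
      have h2 := he.one_eq hF.smooth hN (e.map_target hz)
      rw [e.right_inv hz] at h1 h2
      rw [ha, ha] at h1
      set t := ⟪N (e.symm z), N p⟫_ℝ
      set φ := μ - dirDeriv (adj B a) (height F (N p) e) z
      calc φ ^ 2 = φ ^ 2 * 1 := by ring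
        _ = φ ^ 2 * (t ^ 2 * (1 + gradSq (height F (N p) e) z)) := by rw [← h2]
        _ = (t * φ) ^ 2 * (1 + gradSq (height F (N p) e) z) := by ring
        _ = _ := by rw [← h1]
  refine ⟨B, e, hp, he, h0, hess, ?_⟩
  have h1 := laplacian_of_horizontal h0 (he.graphEquation hF hpt)
  simp only [hess, Finset.sum_const_zero] at h1
  have h2 : height F (N p) e (e p) = 0 := by linarith
  simpa [height, e.left_inv hp] using h2

theorem normal_const_of_inner_const [PreconnectedSpace M] (hF : IsProperSelfShrinker (n := m) F)
    (hN : IsUnitNormalField (n := m) F N) (hμ : 0 < μ) (ha : ∀ q, ⟪N q, a⟫_ℝ = μ) (p q : M) :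
    N p = N q := by
  refine ext_inner_right ℝ fun w => ?_
  refine eq_of_hasFDerivAt_chart_zero (m := m) (s := fun q => ⟪N q, w⟫_ℝ) (fun p => ?_) p q
  obtain ⟨B, e, hp, he, h0, hess, -⟩ := exists_isGraphChart_flat hF hN hμ ha p
  refine ⟨e, he.mem_atlas, hp, ?_⟩
  have hpt := e.map_source hp
  have husm := he.height_contDiffOn hF.smooth
  set u := height F (N p) e with hu
  -- both factors of `⟪N, w⟫ = (μ / φ) (⟪ν, w⟫ - D_w u)` have vanishing derivative
  have hD : ∀ b, HasFDerivAt (dirDeriv b u) (0 : E m →L[ℝ] ℝ) (e p) := fun b => by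
    have hd := (differentiableAt_of_contDiffOn e.open_target
      (dirDeriv_contDiffOn e.open_target husm b) hpt).hasFDerivAt
    refine hd.congr_fderiv ?_
    ext x; exact hess x b
  have h1 : HasFDerivAt (fun z => μ - dirDeriv (adj B a) u z) (0 : E m →L[ℝ] ℝ) (e p) := by
    simpa using (hD (adj B a)).const_sub μ
  have h2 : HasFDerivAt (fun z => ⟪N p, w⟫_ℝ - dirDeriv (adj B w) u z)
      (0 : E m →L[ℝ] ℝ) (e p) := by
    simpa using (hD (adj B w)).const_sub ⟪N p, w⟫_ℝ
  have hne : μ - dirDeriv (adj B a) u (e p) ≠ 0 := by rw [h0, sub_zero]; exact hμ.ne'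
  have h3 : HasFDerivAt (fun z => (μ - dirDeriv (adj B a) u z)⁻¹) (0 : E m →L[ℝ] ℝ) (e p) := by
    have := (hasDerivAt_inv hne).comp_hasFDerivAt (e p) h1
    rwa [smul_zero] at this
  have h4 := (h3.const_mul μ).fun_mul h2
  refine (h4.congr_of_eventuallyEq ?_).congr_fderiv (by simp)
  filter_upwards [e.open_target.mem_nhds hpt] with z hz
  have i1 := he.inner_normal_eq hF.smooth hN a (e.map_target hz)
  have i2 := he.inner_normal_eq hF.smooth hN w (e.map_target hz)
  rw [e.right_inv hz] at i1 i2
  rw [ha, ha] at i1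
  have hφ : μ - dirDeriv (adj B a) u z ≠ 0 := fun h => by
    rw [← hu, h, mul_zero] at i1; exact hμ.ne' i1
  rw [Function.comp_apply, i2]
  congr 1
  rw [← div_eq_mul_inv, eq_div_iff hφ]
  exact i1.symm

theorem isHyperplane_of_inner_const [T2Space M] [ConnectedSpace M]
    (hF : IsProperSelfShrinker (n := m) F) (hN : IsUnitNormalField (n := m) F N) (hμ : 0 < μ)
    (ha : ∀ q, ⟪N q, a⟫_ℝ = μ) : IsHyperplane F := by
  obtain ⟨p₀⟩ := (inferInstance : Nonempty M)
  set ν := N p₀ with hν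
  have hNν : ∀ q, N q = ν := fun q => normal_const_of_inner_const hF hN hμ ha q p₀
  have hFν : ∀ q, ⟪F q, ν⟫_ℝ = 0 := fun q => by
    obtain ⟨-, -, -, -, -, -, h⟩ := exists_isGraphChart_flat hF hN hμ ha q
    rwa [hNν] at h
  obtain ⟨B, hB⟩ := exists_linearIsometry_range_eq _ (finrank_tangentImage hF p₀)
  have hνn : ‖ν‖ = 1 := hN.norm_eq_one p₀
  have hBν : ∀ x, ⟪B x, ν⟫_ℝ = 0 := fun x =>
    (Submodule.mem_orthogonal _ _).mp (hN.normal p₀) _ (hB ▸ ⟨x, rfl⟩)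
  have hproj : ∀ w, ⟪w, ν⟫_ℝ = 0 → B (adj B w) = w := fun w hw => by
    have := range_adj_add_normal hνn hBν w
    rw [hw, zero_smul, add_zero] at this
    exact this.symm
  have htan : ∀ q, LinearMap.range B.toLinearMap = tangentImage (n := m) F q := by
    intro q
    symm
    refine Submodule.eq_of_le_of_finrank_eq (fun w hw => ?_) ?_
    · have hw' : ⟪w, ν⟫_ℝ = 0 := by
        rw [← hNν q]; exact (Submodule.mem_orthogonal _ _).mp (hN.normal q) w hw
      exact ⟨adj B w, hproj w hw'⟩
    · rw [finrank_tangentImage hF q, hB, finrank_tangentImage hF p₀]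
  set G : M → E m := fun q => adj B (F q) with hG
  have hBG : ∀ q, B (G q) = F q := fun q => hproj _ (hFν q)
  have hGloc : IsLocalHomeomorph G := by
    refine IsLocalHomeomorph.mk G fun q => ?_
    obtain ⟨e, hq, he⟩ := exists_isGraphChart hF (htan q) hνn (hNν q ▸ hN.normal q)
    exact ⟨e, hq, fun x hx => (he.apply_eq x hx).symm⟩
  have hGc : Continuous G := (adj B).continuous.comp hF.smooth.continuous
  have hGp : IsProperMap G := isProperMap_of_comp_of_inj hGc B.continuous
    (by have : B ∘ G = F := funext hBG
        rw [this]; exact hF.proper) B.injective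
  obtain ⟨hinj, hsurj⟩ := bijective_of_isLocalHomeomorph_of_isProperMap hGloc hGp
  refine ⟨fun x y hxy => hinj (by simp only [hG, hxy]), LinearMap.range B.toLinearMap, ?_, ?_⟩
  · rw [hB, finrank_tangentImage hF p₀]
  · ext w
    constructor
    · rintro ⟨q, rfl⟩; exact ⟨G q, hBG q⟩
    · rintro ⟨x, rfl⟩
      obtain ⟨q, rfl⟩ := hsurj x
      exact ⟨q, (hBG q).symm⟩

end Flat

/-! ### The vertical flow -/

section Flow

/-- The vertical unit vector `eₖ₊₁`. -/
noncomputable abbrev vert (k : ℕ) : E (k + 1) := stdVec (Fin.last k)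

theorem inner_vert {k : ℕ} (x : E (k + 1)) : ⟪vert k, x⟫_ℝ = x (Fin.last k) := by
  simp [EuclideanSpace.inner_single_left]

theorem norm_vert (k : ℕ) : ‖vert k‖ = 1 := by simp

variable {n : ℕ} {M : Type*} [TopologicalSpace M] {F N : M → E (n + 1 + 1)}

/-- `γ` is a vertical curve through `p` for times in `s`. -/
structure IsVerticalCurveOn (F : M → E (n + 1 + 1)) (p : M) (γ : ℝ → M) (s : Set ℝ) : Prop where
  continuousOn : ContinuousOn γ s
  zero : γ 0 = p
  map_eq : ∀ t ∈ s, F (γ t) = F p + t • vert (n + 1)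

theorem IsVerticalCurveOn.eqOn [T2Space M] (hF : IsLocallyInjective F) {p : M} {γ γ' : ℝ → M}
    {s : Set ℝ} (h : IsVerticalCurveOn F p γ s) (h' : IsVerticalCurveOn F p γ' s)
    (hs : IsPreconnected s) (h0 : (0 : ℝ) ∈ s) : EqOn γ γ' s :=
  (T2Space.isSeparatedMap F).eqOn_of_comp_eqOn hF hs h.continuousOn h'.continuousOn
    (fun t ht => by simp only [Function.comp_apply, h.map_eq t ht, h'.map_eq t ht]) h0
    (h.zero.trans h'.zero.symm)

theorem IsVerticalCurveOn.mono {p : M} {γ : ℝ → M} {s t : Set ℝ}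
    (h : IsVerticalCurveOn F p γ s) (hst : t ⊆ s) : IsVerticalCurveOn F p γ t :=
  ⟨h.continuousOn.mono hst, h.zero, fun x hx => h.map_eq x (hst hx)⟩

variable [ChartedSpace (E (n + 1)) M]

theorem vert_mem_tangentImage (hF : IsProperSelfShrinker (n := n + 1) F)
    (hN : IsUnitNormalField (n := n + 1) F N) (h0 : ∀ q, ⟪N q, vert (n + 1)⟫_ℝ = 0) (q : M) :
    vert (n + 1) ∈ tangentImage (n := n + 1) F q := by
  obtain ⟨B, hB⟩ := exists_linearIsometry_range_eq _ (finrank_tangentImage hF q)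
  have hBν : ∀ x, ⟪B x, N q⟫_ℝ = 0 := fun x =>
    (Submodule.mem_orthogonal _ _).mp (hN.normal q) _ (hB ▸ ⟨x, rfl⟩)
  have := range_adj_add_normal (hN.norm_eq_one q) hBν (vert (n + 1))
  rw [real_inner_comm, h0, zero_smul, add_zero] at this
  rw [← hB]
  exact ⟨_, this.symm⟩

variable [IsManifold (𝓡 (n + 1)) ∞ M]

/-- The chart `e` straightens the vertical direction: its last coordinate is the height of `F`. -/
structure IsVerticalChart (F : M → E (n + 1 + 1)) (e : OpenPartialHomeomorph M (E (n + 1))) :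
    Prop where
  mem_atlas : e ∈ IsManifold.maximalAtlas (𝓡 (n + 1)) ∞ M
  apply_last : ∀ q ∈ e.source, e q (Fin.last n) = F q (Fin.last (n + 1))

/-- If the vertical direction is everywhere tangent, then in a graph chart whose last axis is
vertical the height function does not depend on the last coordinate. -/
theorem exists_isVerticalChart (hF : IsProperSelfShrinker (n := n + 1) F)
    (hN : IsUnitNormalField (n := n + 1) F N) (h0 : ∀ q, ⟪N q, vert (n + 1)⟫_ℝ = 0) (p : M) :
    ∃ e, p ∈ e.source ∧ IsVerticalChart F e ∧ ∃ r > 0, Metric.ball (e p) r ⊆ e.target ∧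
      ∀ z ∈ Metric.ball (e p) r, ∀ t : ℝ, z + t • vert n ∈ Metric.ball (e p) r →
        F (e.symm (z + t • vert n)) = F (e.symm z) + t • vert (n + 1) := by
  obtain ⟨B, hB, hBl⟩ := exists_linearIsometry_range_eq_of_mem _ (finrank_tangentImage hF p)
    (Fin.last n) (vert_mem_tangentImage hF hN h0 p) (norm_vert _)
  obtain ⟨e, hp, he⟩ := exists_isGraphChart hF hB (hN.norm_eq_one p) (hN.normal p)
  have husm := he.height_contDiffOn hF.smooth
  set u := height F (N p) e with hu
  have hlast : ∀ q ∈ e.source, e q (Fin.last n) = F q (Fin.last (n + 1)) := by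
    intro q hq
    rw [he.apply_eq q hq, ← inner_vert, inner_adj, hBl, inner_vert]
  have hDu : ∀ z ∈ e.target, dirDeriv (vert n) u z = 0 := by
    intro z hz
    have h1 := vert_mem_tangentImage hF hN h0 (e.symm z)
    obtain ⟨x, hx⟩ := (he.tangentImage_eq hF.smooth (e.map_target hz) _).mp h1
    rw [e.right_inv hz, ← hBl] at hx
    have h2 : x = vert n := by
      have := congrArg (adj B) hx
      simpa [adj_apply, adj_eq_zero he.inner_normal] using this
    rw [h2] at hx
    have h3 := left_eq_add.mp hx.symm
    have hν : N p ≠ 0 := fun h => by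
      have := hN.norm_eq_one p
      rw [h, norm_zero] at this
      exact zero_ne_one this
    exact (smul_eq_zero.mp h3).resolve_right hν
  obtain ⟨r, hr, hball⟩ := Metric.isOpen_iff.mp e.open_target _ (e.map_source hp)
  refine ⟨e, hp, ⟨he.mem_atlas, hlast⟩, r, hr, hball, fun z hz t ht => ?_⟩
  have huz : u (z + t • vert n) = u z := by
    set s : Set ℝ := {t | z + t • vert n ∈ Metric.ball (e p) r} with hs
    have hsc : Convex ℝ s := by
      have : s = (AffineMap.lineMap z (z + vert n) : ℝ →ᵃ[ℝ] E (n + 1)) ⁻¹'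
          Metric.ball (e p) r := by
        ext t; simp [hs, AffineMap.lineMap_apply, add_comm]
      rw [this]
      exact (convex_ball _ _).affine_preimage _
    have h1 := hsc.norm_image_sub_le_of_norm_hasDerivWithin_le (C := 0)
      (f := fun t : ℝ => u (z + t • vert n)) (f' := fun _ => 0)
      (fun t ht => by
        have := hasDerivAt_line (g := u) (y := z) (a := vert n) (t := t)
          (differentiableAt_of_contDiffOn e.open_target husm (hball ht))
        rw [hDu _ (hball ht)] at this
        exact this.hasDerivWithinAt) (fun _ _ => by simp)
      (show (0 : ℝ) ∈ s by simpa [hs] using hz) (show t ∈ s from ht)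
    simpa [sub_eq_zero] using h1
  have hg1 := he.graph _ (hball hz)
  have hg2 := he.graph _ (hball ht)
  simp only [Function.comp_apply] at hg1 hg2
  rw [hg1, hg2, ← hu, huz, map_add, map_smul, hBl]
  abel

theorem isLocallyInjective (hF : IsProperSelfShrinker (n := n + 1) F)
    (hN : IsUnitNormalField (n := n + 1) F N) : IsLocallyInjective F := by
  intro p
  obtain ⟨O, hO, h⟩ := exists_nhds_chord_not_normal hF hN p
  obtain ⟨U, hUO, hU, hpU⟩ := mem_nhds_iff.mp hO
  exact ⟨U, hU, hpU, fun x hx y hy hxy =>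
    h x (hUO hx) y (hUO hy) 0 (by rw [hxy, sub_self, zero_smul])⟩

/-- The local flow, in a vertical chart: it is a translation of the last coordinate. -/
theorem exists_local_flow (hF : IsProperSelfShrinker (n := n + 1) F)
    (hN : IsUnitNormalField (n := n + 1) F N) (h0 : ∀ q, ⟪N q, vert (n + 1)⟫_ℝ = 0) (p : M) :
    ∃ U, IsOpen U ∧ p ∈ U ∧ ∃ ε > 0, ∃ Θ : M × ℝ → M,
      ContMDiffOn ((𝓡 (n + 1)).prod 𝓘(ℝ, ℝ)) (𝓡 (n + 1)) ∞ Θ (U ×ˢ Ioo (-ε) ε) ∧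
      ∀ q ∈ U, IsVerticalCurveOn F q (fun t => Θ (q, t)) (Ioo (-ε) ε) := by
  obtain ⟨e, hp, he, r, hr, hball, hflow⟩ := exists_isVerticalChart hF hN h0 p
  set U := e.source ∩ e ⁻¹' Metric.ball (e p) (r / 2) with hU
  have hin : ∀ q ∈ U, ∀ t ∈ Ioo (-(r / 2)) (r / 2), e q + t • vert n ∈ Metric.ball (e p) r := by
    intro q hq t ht
    have h1 : ‖e q - e p‖ < r / 2 := by simpa [dist_eq_norm] using hq.2
    have h2 : ‖t • vert n‖ < r / 2 := by
      rw [norm_smul, norm_vert, mul_one, Real.norm_eq_abs]; exact abs_lt.mpr ht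
    rw [Metric.mem_ball, dist_eq_norm, add_sub_right_comm]
    exact (norm_add_le _ _).trans_lt (by linarith)
  have hsm : ContMDiffOn ((𝓡 (n + 1)).prod 𝓘(ℝ, ℝ)) (𝓡 (n + 1)) ∞
      (fun x : M × ℝ => e.symm (e x.1 + x.2 • vert n)) (U ×ˢ Ioo (-(r / 2)) (r / 2)) := by
    refine (contMDiffOn_symm_of_mem_maximalAtlas he.mem_atlas).comp
      (t := e.target) (s := U ×ˢ Ioo (-(r / 2)) (r / 2))
      (f := fun x : M × ℝ => e x.1 + x.2 • vert n) ?_ fun x hx => hball (hin _ hx.1 _ hx.2)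
    have h1 : ContMDiffOn ((𝓡 (n + 1)).prod 𝓘(ℝ, ℝ)) (𝓡 (n + 1)) ∞
        (fun x : M × ℝ => e x.1) (U ×ˢ Ioo (-(r / 2)) (r / 2)) :=
      (contMDiffOn_of_mem_maximalAtlas he.mem_atlas).comp contMDiff_fst.contMDiffOn
        fun x hx => hx.1.1
    exact h1.add ((contDiff_id.smul contDiff_const).contMDiff.comp contMDiff_snd).contMDiffOn
  refine ⟨U, e.isOpen_inter_preimage Metric.isOpen_ball,
    ⟨hp, Metric.mem_ball_self (half_pos hr)⟩, r / 2, half_pos hr, _, hsm, fun q hq => ?_⟩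
  refine ⟨?_, ?_, fun t ht => ?_⟩
  · exact hsm.continuousOn.comp (by fun_prop) fun t ht => ⟨hq, ht⟩
  · simp [e.left_inv hq.1]
  · have h1 := hflow (e q) (by simpa using hin q hq 0 ⟨by linarith, by linarith⟩) t (hin q hq t ht)
    simpa [e.left_inv hq.1] using h1

theorem exists_uniform_curve (hF : IsProperSelfShrinker (n := n + 1) F)
    (hN : IsUnitNormalField (n := n + 1) F N) (h0 : ∀ q, ⟪N q, vert (n + 1)⟫_ℝ = 0) {K : Set M}
    (hK : IsCompact K) :
    ∃ ε > 0, ∀ q ∈ K, ∃ γ : ℝ → M, Continuous γ ∧ IsVerticalCurveOn F q γ (Icc (-ε) ε) := by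
  refine hK.induction_on (p := fun K => ∃ ε > 0, ∀ q ∈ K, ∃ γ : ℝ → M, Continuous γ ∧
    IsVerticalCurveOn F q γ (Icc (-ε) ε)) ⟨1, one_pos, by simp⟩ ?_ ?_ ?_
  · rintro s t hst ⟨ε, hε, h⟩
    exact ⟨ε, hε, fun q hq => h q (hst hq)⟩
  · rintro s t ⟨ε, hε, h⟩ ⟨ε', hε', h'⟩
    refine ⟨min ε ε', lt_min hε hε', ?_⟩
    rintro q (hq | hq)
    · obtain ⟨γ, hγ, hv⟩ := h q hq
      exact ⟨γ, hγ, hv.mono (Icc_subset_Icc (neg_le_neg (min_le_left _ _)) (min_le_left _ _))⟩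
    · obtain ⟨γ, hγ, hv⟩ := h' q hq
      exact ⟨γ, hγ, hv.mono (Icc_subset_Icc (neg_le_neg (min_le_right _ _)) (min_le_right _ _))⟩
  · intro p _
    obtain ⟨U, hU, hpU, ε, hε, Θ, -, hΘ⟩ := exists_local_flow hF hN h0 p
    refine ⟨U, mem_nhdsWithin_of_mem_nhds (hU.mem_nhds hpU), ε / 2, half_pos hε,
      fun q hq => ?_⟩
    -- stop the curve at the times `± ε / 2`
    have hcl : ∀ t : ℝ, max (-(ε / 2)) (min t (ε / 2)) ∈ Ioo (-ε) ε := fun t =>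
      ⟨lt_of_lt_of_le (by linarith) (le_max_left _ _),
        max_lt (by linarith) (lt_of_le_of_lt (min_le_right _ _) (by linarith))⟩
    have hval : ∀ t ∈ Icc (-(ε / 2)) (ε / 2), max (-(ε / 2)) (min t (ε / 2)) = t := fun t ht => by
      rw [min_eq_left ht.2, max_eq_right ht.1]
    have hc : Continuous fun t : ℝ => Θ (q, max (-(ε / 2)) (min t (ε / 2))) :=
      (hΘ q hq).continuousOn.comp_continuous (by fun_prop) hcl
    refine ⟨_, hc, hc.continuousOn, ?_, fun t ht => ?_⟩
    · rw [hval 0 ⟨by linarith, by linarith⟩]; exact (hΘ q hq).zero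
    · rw [hval t ht]
      exact (hΘ q hq).map_eq t ⟨by linarith [ht.1], by linarith [ht.2]⟩

/-- Vertical curves exist for all times: on a bounded time interval they stay in a compact set, by
properness, where they can be extended by a uniform amount of time. -/
theorem exists_curve_Icc (hF : IsProperSelfShrinker (n := n + 1) F)
    (hN : IsUnitNormalField (n := n + 1) F N) (h0 : ∀ q, ⟪N q, vert (n + 1)⟫_ℝ = 0) (p : M)
    {T : ℝ} (hT : 0 ≤ T) :
    ∃ γ : ℝ → M, Continuous γ ∧ IsVerticalCurveOn F p γ (Icc (-T) T) := by
  have hK : IsCompact (F ⁻¹' Metric.closedBall 0 (‖F p‖ + T)) :=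
    hF.proper.isCompact_preimage (isCompact_closedBall _ _)
  obtain ⟨ε, hε, hcurve⟩ := exists_uniform_curve hF hN h0 hK
  have hstep : ∀ k : ℕ, ∃ γ : ℝ → M, Continuous γ ∧
      IsVerticalCurveOn F p γ (Icc (-(min (k * ε) T)) (min (k * ε) T)) := by
    intro k
    induction k with
    | zero =>
      refine ⟨fun _ => p, continuous_const, continuousOn_const, rfl, fun t ht => ?_⟩
      have : t = 0 := by
        rw [Nat.cast_zero, zero_mul, min_eq_left hT, neg_zero] at ht
        exact le_antisymm ht.2 ht.1
      simp [this]
    | succ k ih =>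
      obtain ⟨γ, hγ, hv⟩ := ih
      set T' := min (k * ε) T with hT'
      have hT'0 : 0 ≤ T' := le_min (by positivity) hT
      have hmem : ∀ t ∈ Icc (-T') T', γ t ∈ F ⁻¹' Metric.closedBall 0 (‖F p‖ + T) := by
        intro t ht
        rw [mem_preimage, mem_closedBall_zero_iff, hv.map_eq t ht]
        refine (norm_add_le _ _).trans (add_le_add le_rfl ?_)
        rw [norm_smul, norm_vert, mul_one, Real.norm_eq_abs]
        exact (abs_le.mpr ht).trans (min_le_right _ _)
      have hl : -T' ∈ Icc (-T') T' := ⟨le_rfl, by linarith⟩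
      have hr : T' ∈ Icc (-T') T' := ⟨by linarith, le_rfl⟩
      obtain ⟨γl, hγl, hvl⟩ := hcurve _ (hmem _ hl)
      obtain ⟨γr, hγr, hvr⟩ := hcurve _ (hmem _ hr)
      have hc : Continuous fun t => if t ≤ -T' then γl (t + T') else
          if t ≤ T' then γ t else γr (t - T') := by
        refine Continuous.if_le (hγl.comp (by fun_prop)) ?_ continuous_id continuous_const ?_
        · refine Continuous.if_le hγ (hγr.comp (by fun_prop)) continuous_id continuous_const ?_
          rintro t rfl
          rw [sub_self]; exact hvr.zero.symm
        · rintro t rfl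
          rw [neg_add_cancel, if_pos (by linarith)]; exact hvl.zero
      have hsucc : min ((k + 1 : ℕ) * ε) T ≤ T' + ε := by
        rw [hT', ← min_add_add_right]
        refine min_le_min (le_of_eq (by push_cast; ring)) (by linarith)
      refine ⟨_, hc, hc.continuousOn, ?_, fun t ht => ?_⟩
      · rcases hT'0.eq_or_lt with h | h
        · rw [← h, if_pos (by simp), add_zero]
          have := hvl.zero
          rw [← h, neg_zero] at this
          exact this.trans hv.zero
        · rw [if_neg (by linarith), if_pos hT'0]; exact hv.zero
      · have ht1 : -(T' + ε) ≤ t := by linarith [ht.1]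
        have ht2 : t ≤ T' + ε := by linarith [ht.2]
        by_cases h1 : t ≤ -T'
        · rw [if_pos h1, hvl.map_eq _ ⟨by linarith, by linarith⟩, hv.map_eq _ hl]
          module
        · rw [if_neg h1]
          by_cases h2 : t ≤ T'
          · rw [if_pos h2, hv.map_eq _ ⟨by linarith, h2⟩]
          · rw [if_neg h2, hvr.map_eq _ ⟨by linarith, by linarith⟩, hv.map_eq _ hr]
            module
  obtain ⟨k, hk⟩ := exists_nat_ge (T / ε)
  obtain ⟨γ, hγ, hv⟩ := hstep k
  rw [min_eq_right ((div_le_iff₀ hε).mp hk)] at hv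
  exact ⟨γ, hγ, hv⟩

theorem exists_curve [T2Space M] (hF : IsProperSelfShrinker (n := n + 1) F)
    (hN : IsUnitNormalField (n := n + 1) F N) (h0 : ∀ q, ⟪N q, vert (n + 1)⟫_ℝ = 0) (p : M) :
    ∃ γ : ℝ → M, IsVerticalCurveOn F p γ univ := by
  have hex : ∀ T : ℝ, ∃ γ : ℝ → M, 0 ≤ T →
      Continuous γ ∧ IsVerticalCurveOn F p γ (Icc (-T) T) := by
    intro T
    by_cases hT : 0 ≤ T
    · obtain ⟨γ, h⟩ := exists_curve_Icc hF hN h0 p hT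
      exact ⟨γ, fun _ => h⟩
    · exact ⟨fun _ => p, fun h => absurd h hT⟩
  choose γ hγ' using hex
  have hγc : ∀ T, 0 ≤ T → Continuous (γ T) := fun T hT => (hγ' T hT).1
  have hγ : ∀ T, 0 ≤ T → IsVerticalCurveOn F p (γ T) (Icc (-T) T) := fun T hT => (hγ' T hT).2
  have hagree : ∀ T, 0 ≤ T → ∀ t ∈ Icc (-T) T, γ (|t| + 1) t = γ T t := by
    intro T hT t ht
    have ht' : t ∈ Icc (-(|t|)) |t| := abs_le.mp le_rfl
    have habs : |t| ≤ T := abs_le.mpr ht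
    exact ((hγ (|t| + 1) (by positivity)).mono (t := Icc (-(|t|)) |t|)
      (Icc_subset_Icc (by linarith) (by linarith))).eqOn (isLocallyInjective hF hN)
      ((hγ T hT).mono (Icc_subset_Icc (by linarith) habs)) isPreconnected_Icc
      ⟨by simp, by simp⟩ ht'
  refine ⟨fun t => γ (|t| + 1) t, ?_, ?_, fun t _ => ?_⟩
  · rw [continuousOn_univ, continuous_iff_continuousAt]
    intro t
    have hev : (fun t => γ (|t| + 1) t) =ᶠ[𝓝 t] γ (|t| + 1) := by
      have : Icc (-(|t| + 1)) (|t| + 1) ∈ 𝓝 t :=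
        Icc_mem_nhds (by linarith [neg_abs_le t]) (by linarith [le_abs_self t])
      filter_upwards [this] with s hs using hagree _ (by positivity) s hs
    exact (hγc _ (by positivity)).continuousAt.congr hev.symm
  · exact (hγ _ (by positivity)).zero
  · exact (hγ _ (by positivity)).map_eq t
      ⟨by linarith [neg_abs_le t], by linarith [le_abs_self t]⟩

/-- The global vertical flow. -/
structure IsVerticalFlow (F : M → E (n + 1 + 1)) (θ : M → ℝ → M) : Prop where
  zero : ∀ p, θ p 0 = p
  add : ∀ p s t, θ (θ p s) t = θ p (s + t)
  map_eq : ∀ p t, F (θ p t) = F p + t • vert (n + 1)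
  contMDiff : ContMDiff ((𝓡 (n + 1)).prod 𝓘(ℝ, ℝ)) (𝓡 (n + 1)) ∞ fun x : M × ℝ => θ x.1 x.2

theorem exists_isVerticalFlow [T2Space M] (hF : IsProperSelfShrinker (n := n + 1) F)
    (hN : IsUnitNormalField (n := n + 1) F N) (h0 : ∀ q, ⟪N q, vert (n + 1)⟫_ℝ = 0) :
    ∃ θ, IsVerticalFlow F θ := by
  have hinj := isLocallyInjective hF hN
  choose θ hθ using exists_curve hF hN h0
  have hzero : ∀ p, θ p 0 = p := fun p => (hθ p).zero
  have hmap : ∀ p t, F (θ p t) = F p + t • vert (n + 1) := fun p t => (hθ p).map_eq t trivial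
  have hadd : ∀ p s t, θ (θ p s) t = θ p (s + t) := by
    intro p s t
    refine (hθ (θ p s)).eqOn hinj (γ' := fun t => θ p (s + t)) ⟨?_, by simp, fun t _ => ?_⟩
      isPreconnected_univ trivial (mem_univ t)
    · exact (hθ p).continuousOn.comp (by fun_prop) fun _ _ => trivial
    · rw [hmap, hmap]; module
  -- smoothness for short times
  have hloc : ∀ p, ∃ U, IsOpen U ∧ p ∈ U ∧ ∃ ε > 0, ∀ q ∈ U, ∀ t ∈ Ioo (-ε) ε,
      ContMDiffAt ((𝓡 (n + 1)).prod 𝓘(ℝ, ℝ)) (𝓡 (n + 1)) ∞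
        (fun x : M × ℝ => θ x.1 x.2) (q, t) := by
    intro p
    obtain ⟨U, hU, hpU, ε, hε, Θ, hΘs, hΘ⟩ := exists_local_flow hF hN h0 p
    refine ⟨U, hU, hpU, ε, hε, fun q hq t ht => ?_⟩
    have hnear : U ×ˢ Ioo (-ε) ε ∈ 𝓝 (q, t) := (hU.prod isOpen_Ioo).mem_nhds ⟨hq, ht⟩
    refine (hΘs.contMDiffAt hnear).congr_of_eventuallyEq ?_
    filter_upwards [hnear] with x hx
    exact ((hθ x.1).mono (subset_univ _)).eqOn hinj (hΘ x.1 hx.1) isPreconnected_Ioo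
      ⟨by linarith, hε⟩ hx.2
  -- propagation of smoothness by the group law
  have hprop : ∀ p t₀, ContMDiffAt (𝓡 (n + 1)) (𝓡 (n + 1)) ∞ (fun q => θ q t₀) p → ∀ t,
      ContMDiffAt ((𝓡 (n + 1)).prod 𝓘(ℝ, ℝ)) (𝓡 (n + 1)) ∞
        (fun x : M × ℝ => θ x.1 x.2) (θ p t₀, t - t₀) →
      ContMDiffAt ((𝓡 (n + 1)).prod 𝓘(ℝ, ℝ)) (𝓡 (n + 1)) ∞
        (fun x : M × ℝ => θ x.1 x.2) (p, t) := by
    intro p t₀ h1 t h2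
    have h3 : ContMDiffAt ((𝓡 (n + 1)).prod 𝓘(ℝ, ℝ)) ((𝓡 (n + 1)).prod 𝓘(ℝ, ℝ)) ∞
        (fun x : M × ℝ => (θ x.1 t₀, x.2 - t₀)) (p, t) := by
      refine ContMDiffAt.prodMk ?_ ?_
      · exact ContMDiffAt.comp (p, t) (g := fun q => θ q t₀) (f := fun x : M × ℝ => x.1) h1
          contMDiffAt_fst
      · exact ((contDiff_id.sub contDiff_const).contMDiff.comp contMDiff_snd).contMDiffAt
    have h4 := ContMDiffAt.comp (p, t) (g := fun x : M × ℝ => θ x.1 x.2) h2 h3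
    refine h4.congr_of_eventuallyEq (Eventually.of_forall fun x => ?_)
    simp [hadd]
  have hslice : ∀ p t, ContMDiffAt ((𝓡 (n + 1)).prod 𝓘(ℝ, ℝ)) (𝓡 (n + 1)) ∞
      (fun x : M × ℝ => θ x.1 x.2) (p, t) →
      ContMDiffAt (𝓡 (n + 1)) (𝓡 (n + 1)) ∞ (fun q => θ q t) p := fun p t h =>
    ContMDiffAt.comp p (g := fun x : M × ℝ => θ x.1 x.2) (f := fun q => (q, t)) h
      (contMDiffAt_id.prodMk contMDiffAt_const)
  -- for fixed `p`, the set of times at which the flow is smooth near `p` is open and closed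
  have hall : ∀ p t, ContMDiffAt (𝓡 (n + 1)) (𝓡 (n + 1)) ∞ (fun q => θ q t) p := by
    intro p
    have hkey : ∀ t₁, ∃ V ∈ 𝓝 t₁, ∀ t₀ ∈ V, ∀ t ∈ V,
        ContMDiffAt (𝓡 (n + 1)) (𝓡 (n + 1)) ∞ (fun q => θ q t₀) p →
        ContMDiffAt (𝓡 (n + 1)) (𝓡 (n + 1)) ∞ (fun q => θ q t) p := by
      intro t₁
      obtain ⟨U, hU, hxU, ε, hε, hs⟩ := hloc (θ p t₁)
      have hcont : Continuous (θ p) := continuousOn_univ.mp (hθ p).continuousOn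
      refine ⟨θ p ⁻¹' U ∩ Ioo (t₁ - ε / 2) (t₁ + ε / 2), inter_mem
        ((hU.preimage hcont).mem_nhds hxU) (Ioo_mem_nhds (by linarith) (by linarith)), ?_⟩
      intro t₀ ht₀ t ht h
      refine hslice p t (hprop p t₀ h t (hs _ ht₀.1 _ ⟨?_, ?_⟩))
      · linarith [ht.2.1, ht₀.2.2]
      · linarith [ht.2.2, ht₀.2.1]
    have hclopen : IsClopen {t | ContMDiffAt (𝓡 (n + 1)) (𝓡 (n + 1)) ∞ (fun q => θ q t) p} := by
      constructor
      · rw [← isOpen_compl_iff, isOpen_iff_mem_nhds]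
        intro t₁ ht₁
        obtain ⟨V, hV, h⟩ := hkey t₁
        filter_upwards [hV] with t ht hsm using ht₁ (h t ht t₁ (mem_of_mem_nhds hV) hsm)
      · rw [isOpen_iff_mem_nhds]
        intro t₁ ht₁
        obtain ⟨V, hV, h⟩ := hkey t₁
        filter_upwards [hV] with t ht using h t₁ (mem_of_mem_nhds hV) t ht ht₁
    have h00 : ContMDiffAt (𝓡 (n + 1)) (𝓡 (n + 1)) ∞ (fun q => θ q 0) p := by
      simp only [hzero]; exact contMDiffAt_id
    exact fun t => (hclopen.eq_univ ⟨0, h00⟩).ge (mem_univ t)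
  refine ⟨θ, hzero, hadd, hmap, fun x => ?_⟩
  obtain ⟨p, t⟩ := x
  refine hprop p t (hall p t) t ?_
  obtain ⟨U, -, hxU, ε, hε, hs⟩ := hloc (θ p t)
  exact hs _ hxU _ (by simpa using hε)

end Flow

/-! ### The splitting `ℝᵏ × ℝ = ℝᵏ⁺¹` -/

section Snoc

variable {k : ℕ}

@[simp] theorem snoc_last (x : E k) (t : ℝ) : snoc x t (Fin.last k) = t := by
  simp [snoc]

@[simp] theorem snoc_castSucc (x : E k) (t : ℝ) (i : Fin k) : snoc x t i.castSucc = x i := by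
  simp [snoc]

theorem ext_castSucc_last {x y : E (k + 1)} (h : ∀ i : Fin k, x i.castSucc = y i.castSucc)
    (hl : x (Fin.last k) = y (Fin.last k)) : x = y := by
  ext i
  induction i using Fin.lastCases with
  | last => exact hl
  | cast i => exact h i

/-- The first `k` coordinates of a point of `ℝᵏ⁺¹`. -/
noncomputable def init (x : E (k + 1)) : E k := WithLp.toLp 2 fun i => x i.castSucc

@[simp] theorem init_apply (x : E (k + 1)) (i : Fin k) : init x i = x i.castSucc := rfl

/-- The identification `ℝᵏ × ℝ ≃ ℝᵏ⁺¹`. -/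
noncomputable def snocEquiv (k : ℕ) : (E k × ℝ) ≃L[ℝ] E (k + 1) :=
  LinearEquiv.toContinuousLinearEquiv
    { toFun := fun p => snoc p.1 p.2
      map_add' := fun p q => ext_castSucc_last (by simp) (by simp)
      map_smul' := fun c p => ext_castSucc_last (by simp) (by simp)
      invFun := fun x => (init x, x (Fin.last k))
      left_inv := fun p => Prod.ext (by ext i; simp) (by simp)
      right_inv := fun x => ext_castSucc_last (by simp) (by simp) }

@[simp] theorem snocEquiv_symm_apply (x : E (k + 1)) :
    (snocEquiv k).symm x = (init x, x (Fin.last k)) := rfl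

@[simp] theorem init_snoc (x : E k) (t : ℝ) : init (snoc x t) = x := by ext i; simp

@[simp] theorem snoc_init (x : E (k + 1)) : snoc (init x) (x (Fin.last k)) = x :=
  ext_castSucc_last (by simp) (by simp)

/-- `init` as a continuous linear map. -/
noncomputable def initL (k : ℕ) : E (k + 1) →L[ℝ] E k :=
  (ContinuousLinearMap.fst ℝ (E k) ℝ).comp (snocEquiv k).symm.toContinuousLinearMap

@[simp] theorem initL_apply (x : E (k + 1)) : initL k x = init x := rfl

/-- `x ↦ (x, 0)` as a continuous linear map. -/
noncomputable def snocZeroL (k : ℕ) : E k →L[ℝ] E (k + 1) :=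
  (snocEquiv k).toContinuousLinearMap.comp (ContinuousLinearMap.inl ℝ (E k) ℝ)

@[simp] theorem snocZeroL_apply (x : E k) : snocZeroL k x = snoc x 0 := rfl

theorem snoc_eq_add (x : E k) (t : ℝ) : snoc x t = snocZeroL k x + t • vert k :=
  ext_castSucc_last (by simp [Fin.castSucc_ne_last]) (by simp)

theorem snoc_inj {x y : E k} {s t : ℝ} : snoc x s = snoc y t ↔ x = y ∧ s = t := by
  constructor
  · intro h
    exact ⟨by simpa using congrArg init h, by simpa using congrArg (fun v => v (Fin.last k)) h⟩
  · rintro ⟨rfl, rfl⟩; rfl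

theorem inner_snoc (x y : E k) (s t : ℝ) :
    ⟪snoc x s, snoc y t⟫_ℝ = ⟪x, y⟫_ℝ + s * t := by
  simp [PiLp.inner_apply, Fin.sum_univ_castSucc, mul_comm]

theorem init_vert : init (vert k) = 0 := by ext i; simp [Fin.castSucc_ne_last]

theorem init_stdVec_castSucc (i : Fin k) : init (stdVec i.castSucc) = (stdVec i : E k) := by
  ext j; simp

theorem stdVec_castSucc_last (i : Fin k) :
    (stdVec i.castSucc : E (k + 1)) (Fin.last k) = 0 := by
  simp [(Fin.castSucc_ne_last i).symm]

end Snoc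

/-! ### The Laplace–Beltrami operator of a cylinder -/

section Cylinder

variable {n k : ℕ}

theorem fderiv_comp_init {W : Type*} [NormedAddCommGroup W] [NormedSpace ℝ W] (g : E n → W)
    (z v : E (n + 1)) :
    fderiv ℝ (fun y => g (init y)) z v = fderiv ℝ g (init z) (init v) := by
  by_cases hg : DifferentiableAt ℝ g (init z)
  · have h : HasFDerivAt (fun y => g (init y)) ((fderiv ℝ g (init z)).comp (initL n)) z :=
      HasFDerivAt.comp z (g := g) (f := initL n) hg.hasFDerivAt (initL n).hasFDerivAt
    rw [h.fderiv]; rfl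
  · have hg' : ¬ DifferentiableAt ℝ (fun y => g (init y)) z := by
      intro h
      refine hg ?_
      have hs : HasFDerivAt (fun w => snoc w (z (Fin.last n))) (snocZeroL n) (init z) := by
        have := (snocZeroL n).hasFDerivAt (x := init z) |>.add_const (z (Fin.last n) • vert n)
        refine this.congr_of_eventuallyEq (Eventually.of_forall fun w => ?_)
        exact snoc_eq_add _ _
      have h' : DifferentiableAt ℝ (fun y => g (init y)) (snoc (init z) (z (Fin.last n))) := by
        rwa [snoc_init]
      have := DifferentiableAt.comp (init z) (g := fun y => g (init y))
        (f := fun w => snoc w (z (Fin.last n))) h' hs.differentiableAt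
      refine this.congr_of_eventuallyEq (Eventually.of_forall fun w => ?_)
      simp
    rw [fderiv_zero_of_not_differentiableAt hg, fderiv_zero_of_not_differentiableAt hg']
    rfl

/-- The parametrization `(y, t) ↦ (g y, t)` of the cylinder over `g`. -/
noncomputable def cylinderMap (g : E n → E k) (z : E (n + 1)) : E (k + 1) :=
  snoc (g (init z)) (z (Fin.last n))

theorem fderiv_cylinderMap {g : E n → E k} {z : E (n + 1)}
    (hg : DifferentiableAt ℝ g (init z)) (v : E (n + 1)) :
    fderiv ℝ (cylinderMap g) z v = snoc (fderiv ℝ g (init z) (init v)) (v (Fin.last n)) := by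
  have h : HasFDerivAt (fun y => g (init y)) ((fderiv ℝ g (init z)).comp (initL n)) z :=
    HasFDerivAt.comp z (g := g) (f := initL n) hg.hasFDerivAt (initL n).hasFDerivAt
  have hl : HasFDerivAt (fun y : E (n + 1) => y (Fin.last n))
      ((ContinuousLinearMap.snd ℝ (E n) ℝ).comp (snocEquiv n).symm.toContinuousLinearMap) z :=
    ((ContinuousLinearMap.snd ℝ (E n) ℝ).comp
      (snocEquiv n).symm.toContinuousLinearMap).hasFDerivAt
  have := (snocEquiv k).toContinuousLinearMap.hasFDerivAt.comp z (h.prodMk hl)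
  have h2 : HasFDerivAt (cylinderMap g) _ z := this
  rw [h2.fderiv]
  rfl

theorem inducedMetric_cylinderMap {g : E n → E k} {z : E (n + 1)}
    (hg : DifferentiableAt ℝ g (init z)) :
    (∀ i j : Fin n, inducedMetric (cylinderMap g) z i.castSucc j.castSucc =
      inducedMetric g (init z) i j) ∧
    (∀ i : Fin n, inducedMetric (cylinderMap g) z i.castSucc (Fin.last n) = 0) ∧
    (∀ i : Fin n, inducedMetric (cylinderMap g) z (Fin.last n) i.castSucc = 0) ∧
    inducedMetric (cylinderMap g) z (Fin.last n) (Fin.last n) = 1 := by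
  simp only [inducedMetric, Matrix.of_apply, fderiv_cylinderMap hg, inner_snoc,
    init_stdVec_castSucc, stdVec_castSucc_last, init_vert]
  simp

/-- The block matrix `diag(A, 1)`. -/
def blockOne (A : Matrix (Fin n) (Fin n) ℝ) : Matrix (Fin (n + 1)) (Fin (n + 1)) ℝ :=
  Matrix.of fun i j => Fin.lastCases (motive := fun _ => ℝ)
    (Fin.lastCases (motive := fun _ => ℝ) 1 (fun _ => 0) j)
    (fun i' => Fin.lastCases (motive := fun _ => ℝ) 0 (fun j' => A i' j') j) i

@[simp] theorem blockOne_castSucc_castSucc (A : Matrix (Fin n) (Fin n) ℝ) (i j : Fin n) :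
    blockOne A i.castSucc j.castSucc = A i j := by simp [blockOne]

@[simp] theorem blockOne_castSucc_last (A : Matrix (Fin n) (Fin n) ℝ) (i : Fin n) :
    blockOne A i.castSucc (Fin.last n) = 0 := by simp [blockOne]

@[simp] theorem blockOne_last_castSucc (A : Matrix (Fin n) (Fin n) ℝ) (i : Fin n) :
    blockOne A (Fin.last n) i.castSucc = 0 := by simp [blockOne]

@[simp] theorem blockOne_last_last (A : Matrix (Fin n) (Fin n) ℝ) :
    blockOne A (Fin.last n) (Fin.last n) = 1 := by simp [blockOne]

theorem inducedMetric_cylinderMap_eq {g : E n → E k} {z : E (n + 1)}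
    (hg : DifferentiableAt ℝ g (init z)) :
    inducedMetric (cylinderMap g) z = blockOne (inducedMetric g (init z)) := by
  obtain ⟨h1, h2, h3, h4⟩ := inducedMetric_cylinderMap hg
  ext i j
  induction i using Fin.lastCases with
  | last =>
    induction j using Fin.lastCases with
    | last => simp [h4]
    | cast j => simp [h3]
  | cast i =>
    induction j using Fin.lastCases with
    | last => simp [h2]
    | cast j => simp [h1]

theorem det_blockOne (A : Matrix (Fin n) (Fin n) ℝ) : (blockOne A).det = A.det := by
  rw [Matrix.det_succ_row _ (Fin.last n), Fin.sum_univ_castSucc]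
  have hsub : (blockOne A).submatrix (Fin.last n).succAbove (Fin.last n).succAbove = A := by
    ext i j; simp
  rw [hsub]
  simp [← two_mul]

theorem inv_blockOne (A : Matrix (Fin n) (Fin n) ℝ) (hA : A.det ≠ 0) :
    (blockOne A)⁻¹ = blockOne A⁻¹ := by
  apply Matrix.inv_eq_right_inv
  have hAA : A * A⁻¹ = 1 := Matrix.mul_nonsing_inv A (isUnit_iff_ne_zero.mpr hA)
  ext i j
  rw [Matrix.mul_apply, Fin.sum_univ_castSucc]
  induction i using Fin.lastCases with
  | last =>
    induction j using Fin.lastCases with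
    | last => simp
    | cast j => simp [(Fin.castSucc_ne_last j).symm]
  | cast i =>
    induction j using Fin.lastCases with
    | last => simp [Fin.castSucc_ne_last i]
    | cast j =>
      have := congrFun (congrFun hAA i) j
      rw [Matrix.mul_apply] at this
      simp [this, Matrix.one_apply]

theorem laplaceBeltrami_cylinderMap {g : E n → E k} {z : E (n + 1)}
    (hg : ∀ᶠ y in 𝓝 (init z), DifferentiableAt ℝ g y) :
    laplaceBeltrami (cylinderMap g) (cylinderMap g) z = snoc (laplaceBeltrami g g (init z)) 0 := by
  have hev : ∀ᶠ y in 𝓝 z, DifferentiableAt ℝ g (init y) :=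
    ((initL n).continuous.tendsto z).eventually hg
  set Ψ : Fin n → E n → E k := fun i y => √(inducedMetric g y).det •
      ∑ j : Fin n, (inducedMetric g y)⁻¹ i j • fderiv ℝ g y (EuclideanSpace.single j 1) with hΨ
  -- the vector fields under the divergence; where the metric degenerates they vanish
  have hcast : ∀ i : Fin n, (fun y => √(inducedMetric (cylinderMap g) y).det •
      ∑ j, (inducedMetric (cylinderMap g) y)⁻¹ i.castSucc j •
        fderiv ℝ (cylinderMap g) y (EuclideanSpace.single j 1)) =ᶠ[𝓝 z]
      fun y => snocZeroL k (Ψ i (init y)) := by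
    intro i
    filter_upwards [hev] with y hy
    rw [inducedMetric_cylinderMap_eq hy, det_blockOne]
    by_cases hdet : (inducedMetric g (init y)).det = 0
    · simp only [hΨ, hdet, Real.sqrt_zero, zero_smul, map_zero]
    · rw [inv_blockOne _ hdet, Fin.sum_univ_castSucc]
      simp only [hΨ, fderiv_cylinderMap hy, init_stdVec_castSucc, stdVec_castSucc_last,
        blockOne_castSucc_castSucc, blockOne_castSucc_last, zero_smul, add_zero, map_smul,
        map_sum, snocZeroL_apply]
  have hlast : (fun y => √(inducedMetric (cylinderMap g) y).det •
      ∑ j, (inducedMetric (cylinderMap g) y)⁻¹ (Fin.last n) j •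
        fderiv ℝ (cylinderMap g) y (EuclideanSpace.single j 1)) =ᶠ[𝓝 z]
      fun y => (fun w => √(inducedMetric g w).det • vert k) (init y) := by
    filter_upwards [hev] with y hy
    rw [inducedMetric_cylinderMap_eq hy, det_blockOne]
    by_cases hdet : (inducedMetric g (init y)).det = 0
    · simp only [hdet, Real.sqrt_zero, zero_smul]
    · rw [inv_blockOne _ hdet, Fin.sum_univ_castSucc]
      have hv : fderiv ℝ (cylinderMap g) y (vert n) = vert k := by
        rw [fderiv_cylinderMap hy, init_vert, map_zero, snoc_eq_add, map_zero]
        simp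
      simp only [blockOne_last_castSucc, blockOne_last_last, zero_smul, Finset.sum_const_zero,
        zero_add, one_smul]
      rw [hv]
  have h1 : ∀ i : Fin n, fderiv ℝ (fun y => snocZeroL k (Ψ i (init y))) z (stdVec i.castSucc) =
      snocZeroL k (fderiv ℝ (Ψ i) (init z) (stdVec i)) := by
    intro i
    rw [fderiv_comp_init (fun w => snocZeroL k (Ψ i w)) z, init_stdVec_castSucc]
    by_cases hd : DifferentiableAt ℝ (Ψ i) (init z)
    · have : HasFDerivAt (fun w => snocZeroL k (Ψ i w))
          ((snocZeroL k).comp (fderiv ℝ (Ψ i) (init z))) (init z) :=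
        (snocZeroL k).hasFDerivAt.comp _ hd.hasFDerivAt
      rw [this.fderiv]; rfl
    · have hd' : ¬ DifferentiableAt ℝ (fun w => snocZeroL k (Ψ i w)) (init z) := by
        intro h
        refine hd ?_
        have := (initL k).differentiableAt.comp (init z) h
        refine this.congr_of_eventuallyEq (Eventually.of_forall fun w => ?_)
        simp
      rw [fderiv_zero_of_not_differentiableAt hd, fderiv_zero_of_not_differentiableAt hd']
      exact (map_zero _).symm
  have h2 : fderiv ℝ (fun y => (fun w => √(inducedMetric g w).det • vert k) (init y)) z
      (vert n) = 0 := by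
    rw [fderiv_comp_init (fun w => √(inducedMetric g w).det • vert k), init_vert, map_zero]
  rw [laplaceBeltrami, Fin.sum_univ_castSucc]
  rw [hlast.fderiv_eq, h2, add_zero, inducedMetric_cylinderMap_eq hev.self_of_nhds, det_blockOne]
  have h3 : ∀ i : Fin n, fderiv ℝ (fun y => √(inducedMetric (cylinderMap g) y).det •
      ∑ j, (inducedMetric (cylinderMap g) y)⁻¹ i.castSucc j •
        fderiv ℝ (cylinderMap g) y (EuclideanSpace.single j 1)) z
        (EuclideanSpace.single i.castSucc 1) =
      snocZeroL k (fderiv ℝ (Ψ i) (init z) (stdVec i)) := fun i => by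
    rw [(hcast i).fderiv_eq, h1]
  simp only [h3]
  rw [← map_sum, ← map_smul]
  rfl

/-- The normal projection splits off the vertical direction. -/
theorem starProjection_orthogonal_snoc {T : Submodule ℝ (E k)} {T' : Submodule ℝ (E (k + 1))}
    (hT : ∀ w, w ∈ T' ↔ init w ∈ T) (x : E k) (t : ℝ) :
    T'ᗮ.starProjection (snoc x t) = snoc (Tᗮ.starProjection x) 0 := by
  have hsub : x - Tᗮ.starProjection x ∈ T := by
    have := Submodule.sub_starProjection_mem_orthogonal (K := Tᗮ) x
    rwa [Submodule.orthogonal_orthogonal] at this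
  refine Submodule.eq_starProjection_of_mem_of_inner_eq_zero ?_ ?_
  · rw [Submodule.mem_orthogonal]
    intro w hw
    rw [← snoc_init w, inner_snoc, mul_zero, add_zero]
    exact (Submodule.mem_orthogonal _ _).mp (Submodule.starProjection_apply_mem Tᗮ x) _
      ((hT w).mp hw)
  · intro w hw
    have hmem : snoc x t - snoc (Tᗮ.starProjection x) 0 ∈ T' := by
      rw [hT]
      have : init (snoc x t - snoc (Tᗮ.starProjection x) 0) = x - Tᗮ.starProjection x := by
        ext i; simp
      rw [this]; exact hsub
    exact (Submodule.mem_orthogonal _ _).mp hw _ hmem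

end Cylinder

/-! ### The base of a self-shrinking cylinder is a self-shrinker -/

section Base

variable {n k : ℕ} {M S : Type*} [TopologicalSpace M] [ChartedSpace (E (n + 1)) M]
  [TopologicalSpace S] [ChartedSpace (E n) S]

/-- The chart of `M ≅ S × ℝ` given by a chart of `S` and the coordinate of `ℝ`. -/
noncomputable def cylinderChart (Φ : M ≃ₘ⟮𝓡 (n + 1), (𝓡 n).prod 𝓘(ℝ, ℝ)⟯ (S × ℝ))
    (e : OpenPartialHomeomorph S (E n)) : OpenPartialHomeomorph M (E (n + 1)) :=
  Φ.toHomeomorph.toOpenPartialHomeomorph ≫ₕ (e.prod (OpenPartialHomeomorph.refl ℝ)) ≫ₕ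
    (snocEquiv n).toHomeomorph.toOpenPartialHomeomorph

variable {Φ : M ≃ₘ⟮𝓡 (n + 1), (𝓡 n).prod 𝓘(ℝ, ℝ)⟯ (S × ℝ)} {e : OpenPartialHomeomorph S (E n)}

theorem cylinderChart_apply (p : M) :
    cylinderChart Φ e p = snoc (e (Φ p).1) (Φ p).2 := rfl

theorem cylinderChart_symm_apply (z : E (n + 1)) :
    (cylinderChart Φ e).symm z = Φ.symm (e.symm (init z), z (Fin.last n)) := rfl

theorem mem_cylinderChart_source {p : M} :
    p ∈ (cylinderChart Φ e).source ↔ (Φ p).1 ∈ e.source := by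
  simp [cylinderChart]

theorem mem_cylinderChart_target {z : E (n + 1)} :
    z ∈ (cylinderChart Φ e).target ↔ init z ∈ e.target := by
  simp [cylinderChart]

variable [IsManifold (𝓡 (n + 1)) ∞ M]

theorem cylinderChart_mem_maximalAtlas (he : e ∈ IsManifold.maximalAtlas (𝓡 n) ∞ S) :
    cylinderChart Φ e ∈ IsManifold.maximalAtlas (𝓡 (n + 1)) ∞ M := by
  apply OpenPartialHomeomorph.mem_maximalAtlas_of_contMDiffOn
  · have h1 : ContMDiffOn (𝓡 (n + 1)) (𝓡 n) ∞ (fun p => e (Φ p).1) (cylinderChart Φ e).source :=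
      (contMDiffOn_of_mem_maximalAtlas he).comp
        (contMDiff_fst.comp Φ.contMDiff).contMDiffOn fun p hp => mem_cylinderChart_source.mp hp
    have h2 : ContMDiff (𝓡 (n + 1)) 𝓘(ℝ, ℝ) ∞ (fun p => (Φ p).2) :=
      contMDiff_snd.comp Φ.contMDiff
    have h3 : ContMDiffOn (𝓡 (n + 1)) (𝓡 (n + 1)) ∞ (fun p => snocZeroL n (e (Φ p).1))
        (cylinderChart Φ e).source := (snocZeroL n).contMDiff.comp_contMDiffOn h1
    have h4 : ContMDiff (𝓡 (n + 1)) (𝓡 (n + 1)) ∞ (fun p => (Φ p).2 • vert n) :=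
      (contDiff_id.smul contDiff_const).contMDiff.comp h2
    exact (h3.add h4.contMDiffOn).congr fun p _ => by
      rw [cylinderChart_apply, snoc_eq_add, Pi.add_apply]
  · have h1 : ContMDiffOn (𝓡 (n + 1)) (𝓡 n) ∞ (fun z => e.symm (init z))
        (cylinderChart Φ e).target :=
      (contMDiffOn_symm_of_mem_maximalAtlas he).comp (initL n).contMDiff.contMDiffOn
        fun z hz => mem_cylinderChart_target.mp hz
    have h2 : ContMDiff (𝓡 (n + 1)) 𝓘(ℝ, ℝ) ∞ (fun z : E (n + 1) => z (Fin.last n)) :=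
      ((ContinuousLinearMap.snd ℝ (E n) ℝ).comp
        (snocEquiv n).symm.toContinuousLinearMap).contMDiff
    exact Φ.symm.contMDiff.comp_contMDiffOn (h1.prodMk h2.contMDiffOn)

variable [IsManifold (𝓡 n) ∞ S]

/-- If `M ≅ S × ℝ` is immersed as the cylinder over `G`, and is a self-shrinker, then so is `G`. -/
theorem IsProperSelfShrinker.base {F : M → E (k + 1)} {G : S → E k}
    (hF : IsProperSelfShrinker (n := n + 1) F)
    (Φ : M ≃ₘ⟮𝓡 (n + 1), (𝓡 n).prod 𝓘(ℝ, ℝ)⟯ (S × ℝ))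
    (hFG : ∀ p, F p = snoc (G (Φ p).1) (Φ p).2) : IsProperSelfShrinker (n := n) G := by
  have hFΦ : ∀ s t, F (Φ.symm (s, t)) = snoc (G s) t := fun s t => by simp [hFG]
  have hsmooth : ContMDiff (𝓡 n) 𝓘(ℝ, E k) ∞ G := by
    have h1 : ContMDiff (𝓡 n) (𝓡 (n + 1)) ∞ fun s => Φ.symm (s, 0) :=
      Φ.symm.contMDiff.comp (contMDiff_id.prodMk contMDiff_const)
    have h2 : ContMDiff (𝓡 n) 𝓘(ℝ, E k) ∞ fun s => initL k (F (Φ.symm (s, 0))) :=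
      (initL k).contMDiff.comp (hF.smooth.comp h1)
    simpa [hFΦ] using h2
  -- in the product charts the immersion is the cylinder over the one of the base
  have hcomp : ∀ e : OpenPartialHomeomorph S (E n),
      F ∘ (cylinderChart Φ e).symm = cylinderMap (G ∘ e.symm) := fun e => by
    ext1 z
    rw [Function.comp_apply, cylinderChart_symm_apply, hFΦ]
    rfl
  have hat : ∀ (e : OpenPartialHomeomorph S (E n)) (s : S),
      cylinderChart Φ e (Φ.symm (s, 0)) = snoc (e s) 0 := fun e s => by
    simp [cylinderChart_apply]
  have hsrc : ∀ (e : OpenPartialHomeomorph S (E n)) (s : S), s ∈ e.source →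
      Φ.symm (s, 0) ∈ (cylinderChart Φ e).source := fun e s hs => by
    simpa [mem_cylinderChart_source] using hs
  have hdiff : ∀ e ∈ IsManifold.maximalAtlas (𝓡 n) ∞ S, ∀ s ∈ e.source,
      ∀ᶠ y in 𝓝 (e s), DifferentiableAt ℝ (G ∘ e.symm) y := fun e he s hs => by
    filter_upwards [e.open_target.mem_nhds (e.map_source hs)] with y hy
    exact differentiableAt_of_contDiffOn e.open_target (contDiffOn_comp_chart_symm hsmooth he) hy
  refine ⟨hsmooth, fun s => ?_, ?_, fun e he s hs => ?_⟩
  · have he : chartAt (E n) s ∈ IsManifold.maximalAtlas (𝓡 n) ∞ S :=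
      IsManifold.chart_mem_maximalAtlas s
    have hs := mem_chart_source (E n) s
    rw [injective_mfderiv_iff hsmooth he hs]
    have hinj := (injective_mfderiv_iff hF.smooth (cylinderChart_mem_maximalAtlas he)
      (hsrc _ _ hs)).mp (hF.immersion _)
    rw [hcomp, hat] at hinj
    have hd := (hdiff _ he s hs).self_of_nhds
    intro v w hvw
    have : snoc v 0 = snoc w 0 := by
      apply hinj
      rw [fderiv_cylinderMap (by simpa using hd), fderiv_cylinderMap (by simpa using hd)]
      simpa using congrArg (fun x => snoc x 0) hvw
    exact (snoc_inj.mp this).1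
  · have hι : IsProperMap fun s : S => Φ.symm (s, (0 : ℝ)) := by
      refine Φ.symm.toHomeomorph.isProperMap.comp
        (Topology.IsClosedEmbedding.isProperMap ⟨isEmbedding_prodMkLeft 0, ?_⟩)
      have : range (fun s : S => (s, (0 : ℝ))) = Prod.snd ⁻¹' {0} := by
        ext ⟨s, t⟩; simp [eq_comm]
      rw [this]
      exact isClosed_singleton.preimage continuous_snd
    have h1 : IsProperMap fun s => snocZeroL k (G s) := by
      have : F ∘ (fun s : S => Φ.symm (s, (0 : ℝ))) = fun s => snocZeroL k (G s) :=
        funext fun s => hFΦ s 0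
      exact this ▸ hF.proper.comp hι
    exact isProperMap_of_comp_of_inj hsmooth.continuous (snocZeroL k).continuous h1
      fun x y h => (snoc_inj.mp h).1
  · have he' : cylinderChart Φ e ∈ IsManifold.maximalAtlas (𝓡 (n + 1)) ∞ M :=
      cylinderChart_mem_maximalAtlas he
    have hs' := hsrc e s hs
    have hd := hdiff e he s hs
    have hT : ∀ w, w ∈ tangentImage (n := n + 1) F (Φ.symm (s, 0)) ↔
        init w ∈ tangentImage (n := n) G s := by
      intro w
      rw [tangentImage_eq_range_fderiv hF.smooth he' hs', hcomp, hat,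
        tangentImage_eq_range_fderiv hsmooth he hs, LinearMap.mem_range, LinearMap.mem_range]
      have hd' : DifferentiableAt ℝ (G ∘ e.symm) (init (snoc (e s) 0)) := by
        simpa using hd.self_of_nhds
      constructor
      · rintro ⟨v, rfl⟩
        refine ⟨init v, ?_⟩
        simp [fderiv_cylinderMap hd']
      · rintro ⟨v, hv⟩
        refine ⟨snoc v (w (Fin.last k)), ?_⟩
        have hv' : fderiv ℝ (G ∘ e.symm) (e s) v = init w := hv
        simp [fderiv_cylinderMap hd', hv']
    have h := hF.shrinker _ he' _ hs'
    rw [hcomp, hat, laplaceBeltrami_cylinderMap (by simpa using hd), normalPosition, hFΦ,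
      starProjection_orthogonal_snoc hT, init_snoc] at h
    have h' : (-(1 / 2 : ℝ)) • snoc ((tangentImage (n := n) G s)ᗮ.starProjection (G s)) 0 =
        snocZeroL k (-(1 / 2 : ℝ) • normalPosition (n := n) G s) := by
      rw [map_smul]; rfl
    exact (snoc_inj.mp (h.trans h')).1

end Base

/-! ### The slice of height zero -/

section Slice

variable {n : ℕ} {M : Type*} [TopologicalSpace M] {F : M → E (n + 1 + 1)} {θ : M → ℝ → M}

/-- The points of `M` at which the height of `F` vanishes. -/
abbrev Slice (F : M → E (n + 1 + 1)) : Type _ := {p : M // F p (Fin.last (n + 1)) = 0}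

variable [ChartedSpace (E (n + 1)) M]

/-- The projection onto the slice along the vertical flow. -/
def IsVerticalFlow.proj (hθ : IsVerticalFlow F θ) (p : M) : Slice F :=
  ⟨θ p (-F p (Fin.last (n + 1))), by simp [hθ.map_eq]⟩

theorem IsVerticalFlow.proj_flow (hθ : IsVerticalFlow F θ) (s : Slice F) (t : ℝ) :
    hθ.proj (θ s.1 t) = s := by
  apply Subtype.ext
  simp [IsVerticalFlow.proj, hθ.map_eq, hθ.add, s.2, hθ.zero]

theorem IsVerticalFlow.proj_coe (hθ : IsVerticalFlow F θ) (s : Slice F) : hθ.proj s.1 = s := by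
  have := hθ.proj_flow s 0
  rwa [hθ.zero] at this

theorem contMDiff_height (hF : ContMDiff (𝓡 (n + 1)) 𝓘(ℝ, E (n + 1 + 1)) ∞ F) :
    ContMDiff (𝓡 (n + 1)) 𝓘(ℝ, ℝ) ∞ fun p => F p (Fin.last (n + 1)) :=
  ((ContinuousLinearMap.snd ℝ (E (n + 1)) ℝ).comp
    (snocEquiv (n + 1)).symm.toContinuousLinearMap).contMDiff.comp hF

theorem IsVerticalFlow.contMDiff_coe_proj (hθ : IsVerticalFlow F θ)
    (hF : ContMDiff (𝓡 (n + 1)) 𝓘(ℝ, E (n + 1 + 1)) ∞ F) :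
    ContMDiff (𝓡 (n + 1)) (𝓡 (n + 1)) ∞ fun p => (hθ.proj p : M) :=
  hθ.contMDiff.comp (contMDiff_id.prodMk
    (contDiff_neg.contMDiff.comp (contMDiff_height hF)))

variable {e : OpenPartialHomeomorph M (E (n + 1))}

theorem IsVerticalChart.snoc_init_apply (he : IsVerticalChart F e) {s : Slice F}
    (hs : s.1 ∈ e.source) : snoc (init (e s.1)) 0 = e s.1 := by
  have := snoc_init (e s.1)
  rwa [he.apply_last _ hs, s.2] at this

theorem IsVerticalChart.coe_proj_symm (he : IsVerticalChart F e) (hθ : IsVerticalFlow F θ)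
    {y : E n} (hy : snoc y 0 ∈ e.target) :
    (hθ.proj (e.symm (snoc y 0)) : M) = e.symm (snoc y 0) := by
  have h := he.apply_last _ (e.map_target hy)
  rw [e.right_inv hy, snoc_last] at h
  exact congrArg Subtype.val (hθ.proj_coe ⟨_, h.symm⟩)

/-- The chart of the slice induced by a vertical chart, which identifies the slice with
`ℝⁿ × {0}`. -/
noncomputable def sliceChart (hF : ContMDiff (𝓡 (n + 1)) 𝓘(ℝ, E (n + 1 + 1)) ∞ F)
    (hθ : IsVerticalFlow F θ) (he : IsVerticalChart F e) :
    OpenPartialHomeomorph (Slice F) (E n) where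
  toFun s := init (e s.1)
  invFun y := hθ.proj (e.symm (snoc y 0))
  source := {s | s.1 ∈ e.source}
  target := {y | snoc y 0 ∈ e.target}
  map_source' s hs := by
    rw [mem_ofPred_eq, he.snoc_init_apply hs]; exact e.map_source hs
  map_target' y hy := by
    rw [mem_ofPred_eq, he.coe_proj_symm hθ hy]; exact e.map_target hy
  left_inv' s hs := by
    rw [he.snoc_init_apply hs, e.left_inv hs, hθ.proj_coe]
  right_inv' y hy := by
    rw [he.coe_proj_symm hθ hy, e.right_inv hy, init_snoc]
  open_source := e.open_source.preimage continuous_subtype_val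
  open_target := e.open_target.preimage (snocZeroL n).continuous
  continuousOn_toFun :=
    (initL n).continuous.comp_continuousOn
      (e.continuousOn.comp continuous_subtype_val.continuousOn fun _ hs => hs)
  continuousOn_invFun := by
    have hc : Continuous hθ.proj :=
      continuous_induced_rng.mpr (hθ.contMDiff_coe_proj hF).continuous
    exact hc.comp_continuousOn
      (e.continuousOn_symm.comp (snocZeroL n).continuous.continuousOn fun _ hy => hy)

/-- The slice is a smooth manifold, and the inclusion and the projection along the vertical flow
are smooth. -/
theorem exists_isManifold_slice (hF : ContMDiff (𝓡 (n + 1)) 𝓘(ℝ, E (n + 1 + 1)) ∞ F)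
    (hθ : IsVerticalFlow F θ) (hex : ∀ p, ∃ e, p ∈ e.source ∧ IsVerticalChart F e) :
    ∃ (_ : ChartedSpace (E n) (Slice F)) (_ : IsManifold (𝓡 n) ∞ (Slice F)),
      ContMDiff (𝓡 n) (𝓡 (n + 1)) ∞ (Subtype.val : Slice F → M) ∧
      ContMDiff (𝓡 (n + 1)) (𝓡 n) ∞ hθ.proj := by
  choose c hc hcv using hex
  let inst : ChartedSpace (E n) (Slice F) :=
    { atlas := {f | ∃ (e : _) (he : IsVerticalChart F e), f = sliceChart hF hθ he}
      chartAt := fun s => sliceChart hF hθ (hcv s.1)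
      mem_chart_source := fun s => hc s.1
      chart_mem_atlas := fun s => ⟨_, _, rfl⟩ }
  have hman : IsManifold (𝓡 n) ∞ (Slice F) := by
    apply isManifold_of_contDiffOn
    rintro _ _ ⟨e, he, rfl⟩ ⟨e', he', rfl⟩
    have h : ContMDiffOn (𝓡 n) (𝓡 n) ∞ (fun y => initL n (e' (e.symm (snocZeroL n y))))
        {y | snoc y 0 ∈ e.target ∧ e.symm (snoc y 0) ∈ e'.source} := by
      refine (initL n).contMDiff.comp_contMDiffOn
        ((contMDiffOn_of_mem_maximalAtlas he'.mem_atlas).comp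
          ((contMDiffOn_symm_of_mem_maximalAtlas he.mem_atlas).comp
            (snocZeroL n).contMDiff.contMDiffOn fun y hy => hy.1) fun y hy => hy.2)
    refine (contMDiffOn_iff_contDiffOn.mp h).congr_mono ?_ ?_
    · rintro y ⟨⟨hy, -⟩, -⟩
      exact congrArg (fun q => init (e' q)) (he.coe_proj_symm hθ hy)
    · rintro y ⟨⟨hy, hy'⟩, -⟩
      refine ⟨hy, ?_⟩
      have h : (hθ.proj (e.symm (snoc y 0)) : M) ∈ e'.source := hy'
      have h' : (hθ.proj (e.symm (snoc y 0)) : M) = e.symm (snoc y 0) := he.coe_proj_symm hθ hy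
      rwa [h'] at h
  have hatlas : ∀ s : Slice F, sliceChart hF hθ (hcv s.1) ∈ IsManifold.maximalAtlas (𝓡 n) ∞ _ :=
    fun s => IsManifold.chart_mem_maximalAtlas s
  refine ⟨inst, hman, fun s => ?_, fun p => ?_⟩
  · have h : ContMDiffOn (𝓡 n) (𝓡 (n + 1)) ∞
        (fun q : Slice F => (c s.1).symm (snocZeroL n (sliceChart hF hθ (hcv s.1) q)))
        (sliceChart hF hθ (hcv s.1)).source :=
      (contMDiffOn_symm_of_mem_maximalAtlas (hcv s.1).mem_atlas).comp
        ((snocZeroL n).contMDiff.comp_contMDiffOn (contMDiffOn_of_mem_maximalAtlas (hatlas s)))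
        fun q hq => (sliceChart hF hθ (hcv s.1)).map_source hq
    have hn := (sliceChart hF hθ (hcv s.1)).open_source.mem_nhds (hc s.1)
    refine (h.contMDiffAt hn).congr_of_eventuallyEq ?_
    filter_upwards [hn] with q hq
    have : (c s.1).symm (snoc (init (c s.1 q.1)) 0) = q.1 := by
      rw [(hcv s.1).snoc_init_apply hq, (c s.1).left_inv hq]
    exact this.symm
  · set s := hθ.proj p with hs
    have hsm := hθ.contMDiff_coe_proj hF
    have hO : IsOpen {q | (hθ.proj q : M) ∈ (c s.1).source} :=
      (c s.1).open_source.preimage hsm.continuous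
    have h : ContMDiffOn (𝓡 (n + 1)) (𝓡 n) ∞
        (fun q => (sliceChart hF hθ (hcv s.1)).symm (initL n (c s.1 (hθ.proj q))))
        {q | (hθ.proj q : M) ∈ (c s.1).source} := by
      refine (contMDiffOn_symm_of_mem_maximalAtlas (hatlas s)).comp
        ((initL n).contMDiff.comp_contMDiffOn
          ((contMDiffOn_of_mem_maximalAtlas (hcv s.1).mem_atlas).comp hsm.contMDiffOn
            fun q hq => hq)) fun q hq => (sliceChart hF hθ (hcv s.1)).map_source hq
    refine (h.contMDiffAt (hO.mem_nhds (hc s.1))).congr_of_eventuallyEq ?_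
    filter_upwards [hO.mem_nhds (hc s.1)] with q hq
    exact ((sliceChart hF hθ (hcv s.1)).left_inv hq).symm

end Slice

/-- If the vertical direction is everywhere tangent, the immersed hypersurface is a cylinder. -/
theorem isShrinkerCylinder_of_inner_eq_zero {n : ℕ} {M : Type*} [TopologicalSpace M] [T2Space M]
    [SecondCountableTopology M] [ChartedSpace (E (n + 1)) M] [IsManifold (𝓡 (n + 1)) ∞ M]
    [ConnectedSpace M] {F N : M → E (n + 1 + 1)} (hF : IsProperSelfShrinker (n := n + 1) F)
    (hN : IsUnitNormalField (n := n + 1) F N) (h0 : ∀ q, ⟪N q, vert (n + 1)⟫_ℝ = 0) :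
    IsShrinkerCylinder F := by
  obtain ⟨θ, hθ⟩ := exists_isVerticalFlow hF hN h0
  obtain ⟨_, _, hι, hπ⟩ := exists_isManifold_slice hF.smooth hθ fun p => by
    obtain ⟨e, hp, he, -⟩ := exists_isVerticalChart hF hN h0 p
    exact ⟨e, hp, he⟩
  have hconn : ConnectedSpace (Slice F) := by
    have hsurj : Function.Surjective hθ.proj := fun s => ⟨s.1, hθ.proj_coe s⟩
    exact hsurj.connectedSpace hπ.continuous
  have hheight : ∀ (s : Slice F) t, F (θ s.1 t) (Fin.last (n + 1)) = t := fun s t => by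
    simp [hθ.map_eq, s.2]
  let Φ : M ≃ₘ⟮𝓡 (n + 1), (𝓡 n).prod 𝓘(ℝ, ℝ)⟯ (Slice F × ℝ) :=
    { toFun := fun p => (hθ.proj p, F p (Fin.last (n + 1)))
      invFun := fun x => θ x.1.1 x.2
      left_inv := fun p => by
        change θ (θ p _) _ = p
        rw [hθ.add, neg_add_cancel, hθ.zero]
      right_inv := fun x => Prod.ext (hθ.proj_flow _ _) (hheight _ _)
      contMDiff_toFun := hπ.prodMk (contMDiff_height hF.smooth)
      contMDiff_invFun := hθ.contMDiff.comp ((hι.comp contMDiff_fst).prodMk contMDiff_snd) }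
  have hFG : ∀ p, F p = snoc (init (F (Φ p).1.1)) (Φ p).2 := fun p => by
    have h1 : F (Φ p).1.1 = F p + (-F p (Fin.last (n + 1))) • vert (n + 1) := hθ.map_eq _ _
    refine ext_castSucc_last (fun i => ?_) ?_
    · rw [h1]; simp [Fin.castSucc_ne_last]
    · rw [snoc_last]; rfl
  have hsc : SecondCountableTopology (Slice F) :=
    Topology.IsEmbedding.subtypeVal.secondCountableTopology
  exact ⟨Slice F, inferInstance, inferInstance, inferInstance, inferInstance, hsc, hconn,
    fun s => init (F s.1), Φ, hF.base (G := fun s => init (F s.1)) Φ hFG, hFG⟩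

end Shrinker

theorem theorem1p3 (n : ℕ) (M : Type*) [TopologicalSpace M] [T2Space M]
    [SecondCountableTopology M] [ChartedSpace (Shrinker.E (n + 1)) M]
    [IsManifold (𝓡 (n + 1)) ∞ M] [ConnectedSpace M] [NoncompactSpace M]
    (F : M → Shrinker.E (n + 1 + 1))
    (hF : Shrinker.IsProperSelfShrinker (n := n + 1) F)
    (hG : Shrinker.IsAlmostGraphical F) :
    Shrinker.IsHyperplane F ∨ Shrinker.IsShrinkerCylinder F := by
  obtain ⟨N, hN, hpos⟩ := hG
  have hlast : ∀ q, ⟪N q, Shrinker.vert (n + 1)⟫_ℝ = N q (Fin.last (n + 1)) := fun q => by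
    rw [real_inner_comm, Shrinker.inner_vert]
  obtain ⟨μ, hμ, hconst⟩ := Shrinker.inner_normal_const hF hN (a := Shrinker.vert (n + 1))
    fun q => (hpos q).trans_eq (hlast q).symm
  rcases hμ.eq_or_lt with rfl | hμ
  · exact Or.inr (Shrinker.isShrinkerCylinder_of_inner_eq_zero hF hN hconst)
  · exact Or.inl (Shrinker.isHyperplane_of_inner_const hF hN hμ hconst)
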